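/- Consider a single-input single-output discrete-time plant $x_{k+1}=Ax_k+Bu_k$, $y_k=Cx_k$, with $x_k\in\mathbb R^n$ and scalar $u_k,y_k$, where $(A,B)$ is controllable, $(A,C)$ is observable, and $A$ has at least one eigenvalue of modulus larger than $1$; let $\lambda_0,\dots,\lambda_{n-1}$ be the eigenvalues of $A$ counted with algebraic multiplicity. Let $N\ge 1$ and let $s_1,s_2\in\{0,1\}^N$ be switching patterns in periodic vector form: $s_j$ has $N_j\ge 1$ entries equal to $1$, $N_j$ divides $N$, and $s_j$ is the concatenation of $N_j$ blocks $[1\ 0\ \cdots\ 0]$ of length $N/N_j$. Put $S_{j,k}=s_j(r+1)$ for $k=lN+r$, $0\le r<N$. Let $\theta_{1,k},\theta_{2,k}\in\{0,1\}$ be message-loss processes ($0$ means that the message is lost) such that the pairs $(\theta_{1,k},\theta_{2,k})$, $k\ge 0$, are independent and identically distributed, with $\alpha_j=\Pr\{\theta_{j,k}=0\}$. The controller receives $\hat y_k=\theta_{1,k}S_{1,k}y_k$ and the actuator applies $u_k=\theta_{2,k}S_{2,k}\hat u_k$. The controllers considered are $$\xi_{k+1}=A\xi_k+Bu_k+L_{k,\theta_{2,k}}\bigl(\theta_{1,k}S_{1,k}C\xi_k-\hat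 y_k\bigr),\qquad \hat u_k=F_{k,\theta_{1,k}}\xi_k,$$ with $\xi_k\in\mathbb R^n$ and gains $F_{k,i}$, $L_{k,i}$ that are $N$-periodic in $k$. The closed loop is called stochastically stable if $\mathbb E\bigl[\sum_{k\ge 0}(|x_k|^2+|\xi_k|^2)\bigr]<\infty$ for all initial states $x_0,\xi_0\in\mathbb R^n$. If there is a controller of this form for which the closed loop is stochastically stable, then $$\alpha_j<\frac{1}{\prod_{|\lambda_i|>1}|\lambda_i|^{2N/N_j}}\qquad\text{for } j=1,2. \tag{$*$}$$ Suppose in addition that for $j=1,2$ the sampling with period $N/N_j$ is nonpathological, that is, no two distinct eigenvalues $\lambda\neq\mu$ of $A$ with $|\lambda|\ge 1$ satisfy $\lambda^{N/N_j}=\mu^{N/N_j}$. Then there is a controller of this form for which the closed loop is stochastically stable if and only if $(*)$ holds. -/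

import Mathlib

open MeasureTheory ProbabilityTheory Matrix
open scoped ENNReal

namespace RemoteControl

noncomputable section

/-- A discrete-time single-input single-output plant
`x (k+1) = A x k + B u k`, `y k = C x k`, with scalar `u` and `y`. -/
structure Plant (n : ℕ) where
  A : Matrix (Fin n) (Fin n) ℝ
  B : Fin n → ℝ
  C : Fin n → ℝ

variable {n : ℕ}

/-- The columns `B, A B, …, A ^ (n-1) B` of the controllability matrix span the state space. -/
def Plant.Controllable (G : Plant n) : Prop :=
  Submodule.span ℝ (Set.range fun i : Fin n => (G.A ^ (i : ℕ)) *ᵥ G.B) = ⊤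

/-- The rows `C, C A, …, C A ^ (n-1)` of the observability matrix span the (dual) state space. -/
def Plant.Observable (G : Plant n) : Prop :=
  Submodule.span ℝ (Set.range fun i : Fin n => G.C ᵥ* (G.A ^ (i : ℕ))) = ⊤

/-- The `n` complex eigenvalues of a real matrix, with algebraic multiplicity. -/
def eigenvalues (A : Matrix (Fin n) (Fin n) ℝ) : Multiset ℂ :=
  (A.map (algebraMap ℝ ℂ)).charpoly.roots

/-- At least one eigenvalue lies strictly outside the closed unit disc. -/
def Unstable (A : Matrix (Fin n) (Fin n) ℝ) : Prop :=
  ∃ z ∈ eigenvalues A, 1 < ‖z‖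

open Classical in
/-- The product of `|λ| ^ m` over the eigenvalues `λ` with `|λ| > 1`, counted with
multiplicity. -/
def unstableProd (A : Matrix (Fin n) (Fin n) ℝ) (m : ℕ) : ℝ :=
  (((eigenvalues A).filter fun z => 1 < ‖z‖).map fun z => ‖z‖ ^ m).prod

/-- Sampling with period `d` does not merge two distinct eigenvalues that lie on or outside
the unit circle. -/
def Nonpathological (A : Matrix (Fin n) (Fin n) ℝ) (d : ℕ) : Prop :=
  ∀ z ∈ eigenvalues A, ∀ w ∈ eigenvalues A, 1 ≤ ‖z‖ → z ^ d = w ^ d → z = w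

variable {N : ℕ}

/-- The number of entries `1` of a switching pattern. -/
def numOnes (s : Fin N → Fin 2) : ℕ :=
  (Finset.univ.filter fun r => s r = 1).card

/-- The switching pattern is a concatenation of `m` blocks `1 0 ⋯ 0` of length `N / m`,
where `m ≥ 1` is its number of ones. -/
def IsPeriodicVector (s : Fin N → Fin 2) : Prop :=
  0 < numOnes s ∧ numOnes s ∣ N ∧
    ∀ r : Fin N, s r = if N / numOnes s ∣ (r : ℕ) then 1 else 0

/-- The value of the switch box at time `k = l N + r`, `0 ≤ r < N`. -/
def switch [NeZero N] (s : Fin N → Fin 2) (k : ℕ) : ℝ :=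
  ((s (Fin.ofNat N k) : ℕ) : ℝ)

/-- The `N`-periodic gains of an observer-based controller: `F k i` is the (row) feedback gain
used at time `k` when the sensor channel is in mode `i`, `L k j` is the (column) observer gain
used for the update from `k` to `k + 1` when the actuator channel was in mode `j` at time `k`. -/
structure Controller (n N : ℕ) where
  F : ℕ → Fin 2 → Fin n → ℝ
  L : ℕ → Fin 2 → Fin n → ℝ
  F_periodic : ∀ k i, F (k + N) i = F k i
  L_periodic : ∀ k j, L (k + N) j = L k j

/-- One step of the closed loop from time `k` to time `k + 1`: the plant state is `x`, the
controller state is `ξ`, and `t₁`, `t₂` tell whether the messages at time `k` on the sensor and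
on the actuator channel arrive (`1`) or are lost (`0`). -/
def step [NeZero N] (G : Plant n) (s₁ s₂ : Fin N → Fin 2) (K : Controller n N) (k : ℕ)
    (t₁ t₂ : Fin 2) (x ξ : Fin n → ℝ) : (Fin n → ℝ) × (Fin n → ℝ) :=
  let y : ℝ := G.C ⬝ᵥ x
  let y_hat : ℝ := ((t₁ : ℕ) : ℝ) * switch s₁ k * y
  let u_hat : ℝ := K.F k t₁ ⬝ᵥ ξ
  let u : ℝ := ((t₂ : ℕ) : ℝ) * switch s₂ k * u_hat
  (G.A *ᵥ x + u • G.B,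
    G.A *ᵥ ξ + u • G.B
      + (((t₁ : ℕ) : ℝ) * switch s₁ k * (G.C ⬝ᵥ ξ) - y_hat) • K.L k t₂)

/-- The closed-loop state (plant state, controller state) at each time, for given realizations
`t₁`, `t₂` of the loss processes and given initial states. -/
def closedLoop [NeZero N] (G : Plant n) (s₁ s₂ : Fin N → Fin 2) (K : Controller n N)
    (t₁ t₂ : ℕ → Fin 2) (x₀ ξ₀ : Fin n → ℝ) : ℕ → (Fin n → ℝ) × (Fin n → ℝ)
  | 0 => (x₀, ξ₀)
  | k + 1 =>
    let p := closedLoop G s₁ s₂ K t₁ t₂ x₀ ξ₀ k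
    step G s₁ s₂ K k (t₁ k) (t₂ k) p.1 p.2

variable {Ω : Type*} [MeasurableSpace Ω]

/-- The loss processes (`0` = lost, `1` = arrived): the modes `(θ₁ k, θ₂ k)` are independent and
identically distributed in `k`, with loss probabilities `α₁` and `α₂`. -/
structure IsLossProcess (μ : Measure Ω) (θ₁ θ₂ : ℕ → Ω → Fin 2) (α₁ α₂ : ℝ) : Prop where
  measurable_fst : ∀ k, Measurable (θ₁ k)
  measurable_snd : ∀ k, Measurable (θ₂ k)
  indep : iIndepFun (fun (k : ℕ) (ω : Ω) => (θ₁ k ω, θ₂ k ω)) μ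
  identDistrib : ∀ k : ℕ,
    IdentDistrib (fun ω => (θ₁ k ω, θ₂ k ω)) (fun ω => (θ₁ 0 ω, θ₂ 0 ω)) μ μ
  prob_fst : ∀ k, μ.real {ω | θ₁ k ω = 0} = α₁
  prob_snd : ∀ k, μ.real {ω | θ₂ k ω = 0} = α₂

/-- Stochastic stability of the closed loop: for all initial states, the expectation of
`∑ k, (|x k| ^ 2 + |ξ k| ^ 2)` (Euclidean norms) is finite. -/
def StochasticallyStable [NeZero N] (μ : Measure Ω) (θ₁ θ₂ : ℕ → Ω → Fin 2) (G : Plant n)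
    (s₁ s₂ : Fin N → Fin 2) (K : Controller n N) : Prop :=
  ∀ x₀ ξ₀ : Fin n → ℝ,
    ∫⁻ ω, ∑' k : ℕ, ENNReal.ofReal
      ((∑ i, (closedLoop G s₁ s₂ K (θ₁ · ω) (θ₂ · ω) x₀ ξ₀ k).1 i ^ 2)
        + ∑ i, (closedLoop G s₁ s₂ K (θ₁ · ω) (θ₂ · ω) x₀ ξ₀ k).2 i ^ 2) ∂μ < ∞

end

end RemoteControl

/-! The observer is told the applied input, so the error `ξ - x` follows an autonomous recursion
with matrices `A + S₁θ₁ L C`; and if `ξ = x` initially, then `ξ = x` forever and `x` follows a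
recursion with matrices `A + S₂θ₂ B F`. Stability therefore contains two separate mean-square
problems, one per channel, whatever the correlation of the two losses, and conversely the loop is a
cascade of these two problems.

Necessity. Let `Au` be the block of `A` carrying the eigenvalues with `|λ| > 1`, and compress the
second moments of the error to it. In one step the determinant of the compressed moment is
multiplied by at least `(det Au)²`, or by at least `α (det Au)²` at a sampling instant, because an
arriving scalar measurement can only cause a rank-one loss (`det_kraus_ge`). A sampling period `d =
N / Nⱼ` thus contributes a factor at least `α |det Au|^(2d)`. The moments tend to zero, so this
factor is below one (`lt_one_of_trace_tendsto_zero`). The control channel is the same statement for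
`Aᵀ`, reached through adjoint moments, which have the same trace.

Sufficiency. For the modes with `|λ| ≥ 1`, sampled once per period, take `H = (bA)^d` with `b`
slightly above one and `g = (bA)^(d-1) B`. The backward-time Gramian `W` satisfies `H W Hᵀ = W + g
gᵀ`, hence `(det H)² = 1 + gᵀ W⁻¹ g`, and `W⁻¹` is a Lyapunov form for an erasure channel as soon as
`α (det H)² ≤ 1` (`exists_static_feedback`). Nonpathological sampling makes `W` positive definite
(`eq_zero_of_sampled_orthogonal`). The modes with `|λ| < 1` are added with an ordinary Lyapunov form
(`exists_certificate`). Applied to `(A, B)` this gives `F`, applied to `(Aᵀ, C)` and read backwards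
in time it gives `L`. The error then decays geometrically in mean square and drives a contracting
observer state (`exists_geometric_bound`). -/

namespace RemoteControl

/-! ### Quadratic forms and monotonicity of the determinant. -/

section QuadraticForms

variable {ι κ : Type*} [Fintype ι] [Fintype κ]

/-- The quadratic form of a square matrix. -/
def quad (P : Matrix ι ι ℝ) (x : ι → ℝ) : ℝ := x ⬝ᵥ P *ᵥ x

theorem quad_one [DecidableEq ι] (x : ι → ℝ) : quad (1 : Matrix ι ι ℝ) x = ∑ i, x i ^ 2 := by
  simp [quad, dotProduct, sq]

theorem quad_add (P Q : Matrix ι ι ℝ) (x : ι → ℝ) : quad (P + Q) x = quad P x + quad Q x := by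
  simp [quad, add_mulVec]

theorem quad_smul (c : ℝ) (P : Matrix ι ι ℝ) (x : ι → ℝ) : quad (c • P) x = c * quad P x := by
  simp [quad, smul_mulVec]

theorem quad_smul_vec (c : ℝ) (P : Matrix ι ι ℝ) (x : ι → ℝ) :
    quad P (c • x) = c ^ 2 * quad P x := by
  simp [quad, mulVec_smul]; ring

theorem quad_sum {σ : Type*} (s : Finset σ) (P : σ → Matrix ι ι ℝ) (x : ι → ℝ) :
    quad (∑ i ∈ s, P i) x = ∑ i ∈ s, quad (P i) x := by
  simp [quad, sum_mulVec, dotProduct_sum]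

theorem quad_mulVec (P : Matrix κ κ ℝ) (A : Matrix κ ι ℝ) (x : ι → ℝ) :
    quad P (A *ᵥ x) = quad (Aᵀ * P * A) x := by
  simp only [quad, ← mulVec_mulVec]
  rw [dotProduct_mulVec x, vecMul_transpose]

theorem quad_vecMulVec (v x : ι → ℝ) : quad (vecMulVec v v) x = (v ⬝ᵥ x) ^ 2 := by
  simp only [quad, vecMulVec_mulVec, op_smul_eq_smul, dotProduct_smul, smul_eq_mul,
    dotProduct_comm x v]
  ring

theorem isSymm_dotProduct {P : Matrix ι ι ℝ} (hP : Pᵀ = P) (x y : ι → ℝ) :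
    x ⬝ᵥ P *ᵥ y = y ⬝ᵥ P *ᵥ x := by
  rw [dotProduct_mulVec, ← mulVec_transpose, hP, dotProduct_comm]

theorem quad_add_vec {P : Matrix ι ι ℝ} (hP : Pᵀ = P) (x y : ι → ℝ) :
    quad P (x + y) = quad P x + 2 * (x ⬝ᵥ P *ᵥ y) + quad P y := by
  simp only [quad, mulVec_add, dotProduct_add, add_dotProduct, isSymm_dotProduct hP y x]
  ring

theorem symm_of_posSemidef {τ : Type*} {P : Matrix τ τ ℝ} (hP : P.PosSemidef) : Pᵀ = P := by
  simpa [IsHermitian] using hP.isHermitian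

theorem quad_nonneg {P : Matrix ι ι ℝ} (hP : P.PosSemidef) (x : ι → ℝ) : 0 ≤ quad P x := by
  simpa [quad] using hP.dotProduct_mulVec_nonneg x

theorem quad_pos {P : Matrix ι ι ℝ} (hP : P.PosDef) {x : ι → ℝ} (hx : x ≠ 0) : 0 < quad P x := by
  simpa [quad] using hP.dotProduct_mulVec_pos hx

theorem posSemidef_of_quad {P : Matrix ι ι ℝ} (h : Pᵀ = P) (hP : ∀ x, 0 ≤ quad P x) :
    P.PosSemidef :=
  .of_dotProduct_mulVec_nonneg (by simpa [IsHermitian] using h) (by simpa [quad] using hP)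

theorem posDef_of_quad {P : Matrix ι ι ℝ} (h : Pᵀ = P) (hP : ∀ x, x ≠ 0 → 0 < quad P x) :
    P.PosDef :=
  .of_dotProduct_mulVec_pos (by simpa [IsHermitian] using h) (by simpa [quad] using fun x => hP x)

/-- Conjugation by a matrix with trivial kernel preserves positive definiteness. -/
theorem posDef_conj {P : Matrix κ κ ℝ} (hP : P.PosDef) {A : Matrix κ ι ℝ}
    (hA : ∀ x, A *ᵥ x = 0 → x = 0) : (Aᵀ * P * A).PosDef := by
  refine posDef_of_quad ?_ fun x hx => ?_
  · simp [transpose_mul, symm_of_posSemidef hP.posSemidef, Matrix.mul_assoc]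
  · rw [← quad_mulVec]
    exact quad_pos hP fun h => hx (hA x h)

theorem posSemidef_conj {P : Matrix κ κ ℝ} (hP : P.PosSemidef) (A : Matrix κ ι ℝ) :
    (Aᵀ * P * A).PosSemidef := by
  simpa using hP.conjTranspose_mul_mul_same A

theorem posSemidef_conj' {P : Matrix κ κ ℝ} (hP : P.PosSemidef) (A : Matrix ι κ ℝ) :
    (A * P * Aᵀ).PosSemidef := by
  simpa using hP.mul_mul_conjTranspose_same A

theorem continuous_quad (P : Matrix ι ι ℝ) : Continuous (quad P) := by
  unfold quad
  fun_prop

/-- A positive definite form dominates every quadratic form. -/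
theorem exists_quad_le {P : Matrix ι ι ℝ} (hP : P.PosDef) (Q : Matrix ι ι ℝ) :
    ∃ C : ℝ, 0 < C ∧ ∀ x, quad Q x ≤ C * quad P x := by
  have hS : IsCompact (Metric.sphere (0 : ι → ℝ) 1) := isCompact_sphere 0 1
  have hne : ∀ x ∈ Metric.sphere (0 : ι → ℝ) 1, quad P x ≠ 0 := fun x hx =>
    (quad_pos hP (by rintro rfl; simp at hx)).ne'
  have hc : ContinuousOn (fun x => quad Q x / quad P x) (Metric.sphere (0 : ι → ℝ) 1) :=
    (continuous_quad Q).continuousOn.div (continuous_quad P).continuousOn hne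
  obtain ⟨C, hC⟩ := (hS.image_of_continuousOn hc).bddAbove
  refine ⟨max C 1, by positivity, fun x => ?_⟩
  rcases eq_or_ne x 0 with rfl | hx
  · simp [quad]
  have hx' : ‖x‖ ≠ 0 := norm_ne_zero_iff.2 hx
  have hu : ‖x‖⁻¹ • x ∈ Metric.sphere (0 : ι → ℝ) 1 := by
    simp [norm_smul, hx']
  have h1 : quad Q (‖x‖⁻¹ • x) / quad P (‖x‖⁻¹ • x) ≤ C := hC ⟨_, hu, rfl⟩
  rw [quad_smul_vec, quad_smul_vec, mul_div_mul_left _ _ (by positivity)] at h1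
  have hp := quad_pos hP hx
  rw [div_le_iff₀ hp] at h1
  exact h1.trans (mul_le_mul_of_nonneg_right (le_max_left _ _) hp.le)

/-- Young's inequality for a positive semidefinite form. -/
theorem quad_add_le {P : Matrix ι ι ℝ} (hP : P.PosSemidef) {ε : ℝ} (hε : 0 < ε) (x y : ι → ℝ) :
    quad P (x + y) ≤ (1 + ε⁻¹) * quad P x + (1 + ε) * quad P y := by
  have h := quad_nonneg hP (ε⁻¹ • x - y)
  have hs := symm_of_posSemidef hP
  rw [sub_eq_add_neg, quad_add_vec hs, quad_smul_vec, ← neg_one_smul ℝ y, quad_smul_vec,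
    mulVec_smul, dotProduct_smul, smul_dotProduct] at h
  rw [quad_add_vec hs]
  simp only [smul_eq_mul] at h
  have h2 := mul_nonneg hε.le h
  have e1 : ε * (ε⁻¹ ^ 2 * quad P x + 2 * (-1 * (ε⁻¹ * x ⬝ᵥ P *ᵥ y)) + (-1) ^ 2 * quad P y)
      = ε⁻¹ * quad P x - 2 * (x ⬝ᵥ P *ᵥ y) + ε * quad P y := by
    field_simp
    ring
  linarith

/-- Every eigenvalue of `1 + Z` is at least one, as its Rayleigh quotient at a unit eigenvector
shows. -/
theorem one_le_det_one_add [DecidableEq ι] {Z : Matrix ι ι ℝ} (hZ : Z.PosSemidef) :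
    1 ≤ (1 + Z).det := by
  have h1 : (1 + Z).PosSemidef := PosSemidef.one.add hZ
  rw [h1.isHermitian.det_eq_prod_eigenvalues]
  refine Finset.prod_induction _ (fun x : ℝ => 1 ≤ x) (fun _ _ => one_le_mul_of_one_le_of_one_le)
    le_rfl fun i _ => ?_
  have hi := h1.isHermitian.eigenvalues_eq i
  set v := h1.isHermitian.eigenvectorBasis i
  have hv : star v.ofLp ⬝ᵥ v.ofLp = 1 := by
    have := h1.isHermitian.eigenvectorBasis.orthonormal.1 i
    rw [EuclideanSpace.norm_eq, Real.sqrt_eq_one] at this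
    simpa [dotProduct, sq, v] using this
  have hz : 0 ≤ star v.ofLp ⬝ᵥ Z *ᵥ v.ofLp := hZ.dotProduct_mulVec_nonneg _
  rw [add_mulVec, one_mulVec, dotProduct_add, hv] at hi
  simp only [map_add, RCLike.re_to_real] at hi
  simp only [RCLike.ofReal_real_eq_id, id]
  linarith

/-- For singular `X` only `0 ≤ det Y` is needed. Otherwise factor `X = Rᵀ R`; then `Y = Rᵀ (1 + Z)
R` with `Z` positive semidefinite. -/
theorem det_le_det_of_quad_le [DecidableEq ι] {X Y : Matrix ι ι ℝ} (hX : X.PosSemidef)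
    (hY : Yᵀ = Y) (h : ∀ x, quad X x ≤ quad Y x) : X.det ≤ Y.det := by
  have hYp : Y.PosSemidef := posSemidef_of_quad hY fun x => (quad_nonneg hX x).trans (h x)
  rcases eq_or_ne X.det 0 with h0 | h0
  · rw [h0]; exact hYp.det_nonneg
  obtain ⟨R, hR⟩ : ∃ R : Matrix ι ι ℝ, X = Rᴴ * R := by
    open scoped MatrixOrder in
    obtain ⟨R, hR⟩ := CStarAlgebra.nonneg_iff_eq_star_mul_self.1 hX.nonneg
    exact ⟨R, hR⟩
  rw [conjTranspose_eq_transpose_of_trivial] at hR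
  have hRd : IsUnit R.det := by
    rw [isUnit_iff_ne_zero]
    intro h1
    exact h0 (by rw [hR, det_mul, h1, mul_zero])
  set Z := R⁻¹ᵀ * (Y - X) * R⁻¹
  have hZ : Z.PosSemidef := posSemidef_conj (posSemidef_of_quad
    (by simp [hY, symm_of_posSemidef hX]) fun x => by
      have := h x
      rw [sub_eq_add_neg, ← neg_one_smul ℝ X, quad_add, quad_smul]; linarith) _
  have hYe : Y = Rᵀ * (1 + Z) * R := by
    have h1 : Rᵀ * R⁻¹ᵀ = 1 := by rw [← transpose_mul, nonsing_inv_mul _ hRd, transpose_one]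
    have h2 : Rᵀ * Z * R = (Rᵀ * R⁻¹ᵀ) * (Y - X) * (R⁻¹ * R) := by simp only [Z, Matrix.mul_assoc]
    rw [Matrix.mul_add, Matrix.add_mul, h2, h1, nonsing_inv_mul _ hRd]
    simp [← hR]
  have hone := one_le_det_one_add hZ
  rw [hYe, hR, det_mul, det_mul, det_mul, det_transpose]
  nlinarith [mul_self_nonneg R.det]

end QuadraticForms

/-! ### Decay of matrix powers and the Stein equation. -/

section Spectral

variable {n : ℕ}

theorem mem_eigenvalues_iff {A : Matrix (Fin n) (Fin n) ℝ} {z : ℂ} :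
    z ∈ eigenvalues A ↔ z ∈ spectrum ℂ (A.map (algebraMap ℝ ℂ)) := by
  rw [mem_spectrum_iff_isRoot_charpoly, eigenvalues,
    Polynomial.mem_roots (charpoly_monic _).ne_zero]

section LinftyNorm

attribute [local instance] Matrix.linftyOpNormedRing Matrix.linftyOpNormedAlgebra

theorem norm_entry_le_linfty_opNorm (X : Matrix (Fin n) (Fin n) ℂ) (i j : Fin n) :
    ‖X i j‖ ≤ ‖X‖ := by
  rw [linfty_opNorm_def]
  have h3 : ‖X i j‖₊ ≤ ∑ j, ‖X i j‖₊ :=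
    Finset.single_le_sum (f := fun j => ‖X i j‖₊) (fun _ _ => zero_le) (Finset.mem_univ j)
  have h4 : ∑ j, ‖X i j‖₊ ≤ Finset.univ.sup fun i => ∑ j, ‖X i j‖₊ :=
    Finset.le_sup (f := fun i => ∑ j, ‖X i j‖₊) (Finset.mem_univ i)
  exact_mod_cast h3.trans h4

/-- Gelfand's formula gives `‖A ^ k‖ ≤ R ^ k` for large `k`, since `R` strictly exceeds the spectral
radius; the finitely many earlier powers are absorbed in `c`. -/
theorem exists_pow_entry_le (A : Matrix (Fin n) (Fin n) ℝ) {R : ℝ} (hR : 0 < R)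
    (h : ∀ z ∈ eigenvalues A, ‖z‖ < R) :
    ∃ c : ℝ, 0 < c ∧ ∀ k i j, |(A ^ k) i j| ≤ c * R ^ k := by
  rcases Nat.eq_zero_or_pos n with rfl | hn
  · exact ⟨1, one_pos, fun k i => i.elim0⟩
  have : NeZero n := ⟨hn.ne'⟩
  set X : Matrix (Fin n) (Fin n) ℂ := A.map (algebraMap ℝ ℂ) with hX
  have hcomp : CompleteSpace (Matrix (Fin n) (Fin n) ℂ) := FiniteDimensional.complete ℂ _
  have hrad : spectralRadius ℂ X < (R.toNNReal : ℝ≥0∞) := by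
    refine spectrum.spectralRadius_lt_of_forall_lt X fun z hz => ?_
    have := h z (mem_eigenvalues_iff.2 hz)
    rw [← NNReal.coe_lt_coe, Real.coe_toNNReal _ hR.le]
    exact this
  have hev := (spectrum.pow_nnnorm_pow_one_div_tendsto_nhds_spectralRadius X).eventually_lt_const
    hrad
  have hev2 : ∀ᶠ k : ℕ in Filter.atTop, ‖X ^ k‖ ≤ R ^ k := by
    filter_upwards [hev, Filter.eventually_gt_atTop 0] with k hk hk0
    have h1 := ENNReal.rpow_le_rpow hk.le (Nat.cast_nonneg k : (0 : ℝ) ≤ k)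
    rw [← ENNReal.rpow_mul, one_div, inv_mul_cancel₀ (by positivity), ENNReal.rpow_one,
      ENNReal.rpow_natCast, ← ENNReal.coe_pow, ENNReal.coe_le_coe] at h1
    rw [← NNReal.coe_le_coe] at h1
    simpa [Real.coe_toNNReal _ hR.le] using h1
  obtain ⟨K, hK⟩ := Filter.eventually_atTop.1 hev2
  have hent : ∀ k i j, |(A ^ k) i j| ≤ ‖X ^ k‖ := fun k i j => by
    have e : (X ^ k) i j = (((A ^ k) i j : ℝ) : ℂ) := by
      have : X ^ k = (A ^ k).map (algebraMap ℝ ℂ) := by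
        rw [hX, ← RingHom.mapMatrix_apply, ← RingHom.mapMatrix_apply, map_pow]
      rw [this]; rfl
    have e2 : |(A ^ k) i j| = ‖(X ^ k) i j‖ := by rw [e, Complex.norm_real, Real.norm_eq_abs]
    rw [e2]
    exact norm_entry_le_linfty_opNorm _ _ _
  obtain ⟨f, hf⟩ : ∃ f : ℕ → ℝ, ∀ k, f k = ‖X ^ k‖ := ⟨_, fun _ => rfl⟩
  simp only [← hf] at hent hK
  have hf0 : ∀ k, 0 ≤ f k / R ^ k := fun k => by
    rw [hf]; exact div_nonneg (norm_nonneg _) (pow_nonneg hR.le _)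
  have hs : 0 ≤ ∑ k ∈ Finset.range K, f k / R ^ k := Finset.sum_nonneg fun k _ => hf0 k
  refine ⟨1 + ∑ k ∈ Finset.range K, f k / R ^ k, by positivity, fun k i j => ?_⟩
  refine (hent k i j).trans ?_
  have hRk : 0 < R ^ k := pow_pos hR k
  rcases le_or_gt K k with hk | hk
  · have := hK k hk
    nlinarith
  · have h5 : f k / R ^ k ≤ ∑ k ∈ Finset.range K, f k / R ^ k :=
      Finset.single_le_sum (f := fun k => f k / R ^ k) (fun k _ => hf0 k)
        (Finset.mem_range.2 hk)
    rw [div_le_iff₀ hRk] at h5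
    nlinarith

end LinftyNorm

/-- Solution of the Stein equation `Y = Q + Zᵀ Y Z` for a matrix with decaying powers. -/
theorem exists_stein_solution {ι : Type*} [Fintype ι] [DecidableEq ι] {Z : Matrix ι ι ℝ}
    {c r : ℝ} (hr : 0 ≤ r) (hr1 : r < 1) (hZ : ∀ k i j, |(Z ^ k) i j| ≤ c * r ^ k)
    (Q : Matrix ι ι ℝ) (hQ : Qᵀ = Q) :
    ∃ Y : Matrix ι ι ℝ, Yᵀ = Y ∧ Y = Q + Zᵀ * Y * Z ∧
      ∀ v, HasSum (fun k => quad Q (Z ^ k *ᵥ v)) (quad Y v) := by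
  have hsum : Summable fun k : ℕ => (Z ^ k)ᵀ * Q * Z ^ k := by
    refine (Pi.summable (f := fun k : ℕ => ((Z ^ k)ᵀ * Q * Z ^ k : ι → ι → ℝ))).2 fun i => ?_
    refine Pi.summable.2 fun j => ?_
    have hexp : ∀ k, ((Z ^ k)ᵀ * Q * Z ^ k) i j
        = ∑ b, ∑ a, (Z ^ k) a i * Q a b * (Z ^ k) b j := fun k => by
      simp only [mul_apply, transpose_apply, Finset.sum_mul]
    simp only [hexp]
    refine summable_sum fun b _ => summable_sum fun a _ => ?_
    refine Summable.of_norm_bounded (g := fun k : ℕ => (c * |Q a b| * c) * (r ^ 2) ^ k)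
      ((summable_geometric_of_lt_one (by positivity) (by nlinarith)).mul_left _) fun k => ?_
    rw [Real.norm_eq_abs, abs_mul, abs_mul]
    have h1 := hZ k a i
    have h2 := hZ k b j
    have h3 : 0 ≤ c * r ^ k := (abs_nonneg _).trans h1
    calc |(Z ^ k) a i| * |Q a b| * |(Z ^ k) b j| ≤ (c * r ^ k) * |Q a b| * (c * r ^ k) := by
          gcongr
      _ = c * |Q a b| * c * (r ^ 2) ^ k := by rw [← pow_mul, mul_comm 2 k, pow_mul]; ring
  obtain ⟨Y, hY⟩ := hsum
  have hquad : ∀ v, HasSum (fun k => quad Q (Z ^ k *ᵥ v)) (quad Y v) := fun v => by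
    have hcont : Continuous fun M : Matrix ι ι ℝ => quad M v := by unfold quad; fun_prop
    let φ : Matrix ι ι ℝ →+ ℝ :=
      { toFun := fun M => quad M v
        map_zero' := by simp [quad]
        map_add' := fun _ _ => quad_add _ _ _ }
    have e : (fun k => quad Q (Z ^ k *ᵥ v)) = φ ∘ fun k => (Z ^ k)ᵀ * Q * Z ^ k :=
      funext fun k => quad_mulVec _ _ _
    rw [e]
    exact hY.map φ hcont
  refine ⟨Y, ?_, ?_, hquad⟩
  · have h1 := hY.matrix_transpose
    simp only [transpose_mul, transpose_transpose, hQ, ← Matrix.mul_assoc] at h1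
    exact h1.unique hY
  · have h1 := (hasSum_nat_add_iff' 1).2 hY
    have hcont : Continuous fun M : Matrix ι ι ℝ => Zᵀ * M * Z := by fun_prop
    let φ : Matrix ι ι ℝ →+ Matrix ι ι ℝ :=
      { toFun := fun M => Zᵀ * M * Z
        map_zero' := by simp
        map_add' := fun _ _ => by simp [Matrix.mul_add, Matrix.add_mul] }
    have h2 := hY.map φ hcont
    have h3 : (φ ∘ fun k => (Z ^ k)ᵀ * Q * Z ^ k) = fun k => (Z ^ (k + 1))ᵀ * Q * Z ^ (k + 1) := by
      funext k
      simp only [φ, Function.comp, AddMonoidHom.coe_mk, ZeroHom.coe_mk, pow_succ, transpose_mul, Matrix.mul_assoc]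
    have h4 := h1.unique (h3 ▸ h2)
    simp only [Finset.range_one, Finset.sum_singleton, pow_zero, transpose_one, Matrix.one_mul,
      Matrix.mul_one] at h4
    rw [sub_eq_iff_eq_add'] at h4
    exact h4

end Spectral

/-! ### Real block diagonalization along the spectrum. -/

section Splitting

open Polynomial

variable {n : ℕ}

theorem roots_map_conj (q : ℝ[X]) :
    (q.map (algebraMap ℝ ℂ)).roots.map (starRingEnd ℂ) = (q.map (algebraMap ℝ ℂ)).roots := by
  have h := (IsAlgClosed.splits (q.map (algebraMap ℝ ℂ))).roots_map (starRingEnd ℂ)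
  rw [← h, Polynomial.map_map]
  congr 2
  ext x
  simp

/-- A conjugation-invariant multiset of complex numbers is the root multiset of a monic real
polynomial. -/
theorem exists_real_poly_of_conj_invariant (s : Multiset ℂ)
    (hs : s.map (starRingEnd ℂ) = s) :
    ∃ q : ℝ[X], q.map (algebraMap ℝ ℂ) = (s.map fun a => X - C a).prod := by
  have hlift : (s.map fun a => X - C a).prod ∈ Polynomial.lifts (algebraMap ℝ ℂ) := by
    rw [Polynomial.lifts_iff_coeff_lifts]
    intro k
    -- Conjugation permutes the linear factors, hence fixes every coefficient of the product.
    have h1 : ((s.map fun a => X - C a).prod).map (starRingEnd ℂ)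
        = (s.map fun a => X - C a).prod := by
      conv_rhs => rw [← hs]
      rw [← Polynomial.coe_mapRingHom, map_multiset_prod, Multiset.map_map, Multiset.map_map]
      congr 1
      refine Multiset.map_congr rfl fun a _ => ?_
      simp
    have h2 := congrArg (fun q => q.coeff k) h1
    simp only [coeff_map] at h2
    obtain ⟨r, hr⟩ := Complex.conj_eq_iff_real.1 h2
    exact ⟨r, hr.symm⟩
  exact (Polynomial.mem_lifts _).1 hlift

/-- By spectral mapping `q(z)` lies in the spectrum of `q(M) = 0`, which is `{0}`. -/
theorem isRoot_of_mem_eigenvalues_of_aeval_eq_zero {a : ℕ} {M : Matrix (Fin a) (Fin a) ℝ}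
    {q : ℝ[X]} (h : aeval M q = 0) {z : ℂ} (hz : z ∈ eigenvalues M) :
    (q.map (algebraMap ℝ ℂ)).IsRoot z := by
  set M' : Matrix (Fin a) (Fin a) ℂ := M.map (algebraMap ℝ ℂ) with hM'
  have h1 : aeval M' (q.map (algebraMap ℝ ℂ)) = 0 := by
    have h2 : aeval M' (q.map (algebraMap ℝ ℂ)) = (aeval M q).map (algebraMap ℝ ℂ) := by
      rw [aeval_map_algebraMap]
      have := Polynomial.aeval_algHom_apply (Algebra.ofId ℝ ℂ).mapMatrix M q
      exact this
    rw [h2, h]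
    ext i j
    simp
  have h3 := mem_eigenvalues_iff.1 hz
  have h4 := spectrum.subset_polynomial_aeval M' (q.map (algebraMap ℝ ℂ)) ⟨z, h3, rfl⟩
  rw [h1] at h4
  rcases Nat.eq_zero_or_pos a with rfl | ha
  · simp [eigenvalues, charpoly] at hz
  have : NeZero a := ⟨ha.ne'⟩
  simpa [Polynomial.IsRoot, spectrum.zero_eq] using h4

theorem map_charpoly_eq (A : Matrix (Fin n) (Fin n) ℝ) :
    (A.map (algebraMap ℝ ℂ)).charpoly = A.charpoly.map (algebraMap ℝ ℂ) := charpoly_map A _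

theorem mem_ker_aeval_of_mem {V : Type*} [AddCommGroup V] [Module ℝ V] (f : Module.End ℝ V)
    (q : ℝ[X]) {x : V} (hx : x ∈ LinearMap.ker (aeval f q)) : f x ∈ LinearMap.ker (aeval f q) := by
  have h : aeval f q * aeval f (X : ℝ[X]) = aeval f (X : ℝ[X]) * aeval f q := by
    rw [← map_mul, ← map_mul, mul_comm]
  rw [aeval_X] at h
  have h2 := congrArg (fun g => g x) h
  simp only [Module.End.mul_apply] at h2
  rw [LinearMap.mem_ker] at hx ⊢
  rw [h2, hx, map_zero]

open Classical in
/-- Real block diagonalization along a conjugation-invariant splitting of the spectrum. -/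
theorem exists_spectral_splitting (A : Matrix (Fin n) (Fin n) ℝ) (p : ℂ → Prop)
    (hp : ∀ z, p (starRingEnd ℂ z) ↔ p z) :
    ∃ (a b : ℕ) (Au : Matrix (Fin a) (Fin a) ℝ) (As : Matrix (Fin b) (Fin b) ℝ)
      (T : Matrix (Fin a ⊕ Fin b) (Fin n) ℝ) (S : Matrix (Fin n) (Fin a ⊕ Fin b) ℝ),
      S * T = 1 ∧ T * S = 1 ∧ T * A = fromBlocks Au 0 0 As * T ∧
      eigenvalues Au = (eigenvalues A).filter p ∧
      eigenvalues As = (eigenvalues A).filter fun z => ¬ p z := by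
  set R := eigenvalues A with hR
  have hRc : R.map (starRingEnd ℂ) = R := by
    rw [hR, eigenvalues, map_charpoly_eq, roots_map_conj]
  have hfil : ∀ p : ℂ → Prop, (∀ z, p (starRingEnd ℂ z) ↔ p z) →
      (R.filter p).map (starRingEnd ℂ) = R.filter p := fun p hp => by
    conv_rhs => rw [← hRc]
    rw [Multiset.filter_map]
    congr 1
    exact Multiset.filter_congr fun z _ => (hp z).symm
  obtain ⟨q, hq⟩ := exists_real_poly_of_conj_invariant _ (hfil p hp)
  obtain ⟨q', hq'⟩ := exists_real_poly_of_conj_invariant _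
    (hfil (fun z => ¬ p z) fun z => not_congr (hp z))
  have hinj : Function.Injective (Polynomial.map (algebraMap ℝ ℂ)) :=
    Polynomial.map_injective _ (algebraMap ℝ ℂ).injective
  have hsplit : R.filter p + (R.filter fun z => ¬ p z) = R := by
    convert Multiset.filter_add_not p R
  have hmul : A.charpoly = q * q' := by
    apply hinj
    rw [Polynomial.map_mul, hq, hq', ← Multiset.prod_add, ← Multiset.map_add]
    trans (R.map fun a => X - C a).prod
    · rw [hR, eigenvalues, ← map_charpoly_eq]
      exact (IsAlgClosed.splits _).eq_prod_roots_of_monic (charpoly_monic _)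
    · congr 2
      convert hsplit.symm
  have hqroots : ∀ z, (q.map (algebraMap ℝ ℂ)).IsRoot z → p z := fun z hz => by
    rw [hq, Polynomial.IsRoot, eval_multiset_prod, Multiset.prod_eq_zero_iff] at hz
    simp only [Multiset.map_map, Multiset.mem_map, Multiset.mem_filter, Function.comp] at hz
    obtain ⟨w, ⟨_, hw⟩, h0⟩ := hz
    simp only [eval_sub, eval_X, eval_C, sub_eq_zero] at h0
    rwa [h0]
  have hqroots' : ∀ z, (q'.map (algebraMap ℝ ℂ)).IsRoot z → ¬ p z := fun z hz => by
    rw [hq', Polynomial.IsRoot, eval_multiset_prod, Multiset.prod_eq_zero_iff] at hz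
    simp only [Multiset.map_map, Multiset.mem_map, Multiset.mem_filter, Function.comp] at hz
    obtain ⟨w, ⟨_, hw⟩, h0⟩ := hz
    simp only [eval_sub, eval_X, eval_C, sub_eq_zero] at h0
    rwa [h0]
  -- A common complex root would satisfy `p` and its negation.
  have hcop : IsCoprime q q' := by
    rw [← Polynomial.isCoprime_map (algebraMap ℝ ℂ)]
    refine (Polynomial.isCoprime_iff_aeval_ne_zero_of_isAlgClosed ℂ ℂ _ _).2 fun z => ?_
    by_contra! h
    refine hqroots' z ?_ (hqroots z ?_)
    · rw [Polynomial.IsRoot, ← coe_aeval_eq_eval]; exact h.2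
    · rw [Polynomial.IsRoot, ← coe_aeval_eq_eval]; exact h.1
  let f : Module.End ℝ (Fin n → ℝ) := toLin' A
  let V := LinearMap.ker (aeval f q)
  let W := LinearMap.ker (aeval f q')
  have hVW : IsCompl V W := by
    -- The two kernels together span the kernel of `q q'` at `f`, and `q q'` is the characteristic
    -- polynomial, so Cayley–Hamilton makes this everything.
    refine ⟨Polynomial.disjoint_ker_aeval_of_isCoprime f hcop, ?_⟩
    rw [codisjoint_iff, Polynomial.sup_ker_aeval_eq_ker_aeval_mul_of_coprime f hcop, ← hmul,
      LinearMap.ker_eq_top]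
    have : f.charpoly = A.charpoly := by simp [f]
    rw [← this]
    exact f.aeval_self_charpoly
  have hinv : ∀ q : ℝ[X], ∀ x ∈ LinearMap.ker (aeval f q), f x ∈ LinearMap.ker (aeval f q) :=
    fun q x hx => mem_ker_aeval_of_mem f q hx
  let fV := f.restrict (hinv q)
  let fW := f.restrict (hinv q')
  let bV := Module.finBasis ℝ V
  let bW := Module.finBasis ℝ W
  let e := Submodule.prodEquivOfIsCompl V W hVW
  let bb := (bV.prod bW).map e
  let B := Pi.basisFun ℝ (Fin n)
  have haeval : ∀ (q : ℝ[X]), ∀ x : LinearMap.ker (aeval f q),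
      aeval (f.restrict (hinv q)) q x = 0 := fun q x => by
    have : ∀ r : ℝ[X], ((aeval (f.restrict (hinv q)) r x : LinearMap.ker (aeval f q)) : Fin n → ℝ)
        = aeval f r x := fun r => by
      induction r using Polynomial.induction_on' with
      | add r s hr hs => simp [hr, hs]
      | monomial k c =>
        simp only [aeval_monomial, Module.End.mul_apply, Module.algebraMap_end_apply,
          Submodule.coe_smul]
        rw [Module.End.pow_restrict]
        rfl
    exact Subtype.ext ((this q).trans x.2)
  set Au := LinearMap.toMatrix bV bV fV with hAu
  set As := LinearMap.toMatrix bW bW fW with hAs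
  have hblock : LinearMap.toMatrix bb bb f = fromBlocks Au 0 0 As := by
    have h1 : LinearMap.toMatrix (bV.prod bW) (bV.prod bW) (fV.prodMap fW)
        = fromBlocks Au 0 0 As := LinearMap.toMatrix_prodMap bV bW fV fW
    rw [← h1]
    have h2 : f = (e : _ →ₗ[ℝ] _) ∘ₗ (fV.prodMap fW) ∘ₗ (e.symm : _ →ₗ[ℝ] _) := by
      refine LinearMap.ext fun x => ?_
      obtain ⟨y, rfl⟩ := e.surjective x
      simp [e, fV, fW]
    ext i j
    rw [LinearMap.toMatrix_apply, LinearMap.toMatrix_apply]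
    simp only [bb, Module.Basis.map_apply, Module.Basis.map_repr, LinearEquiv.trans_apply]
    conv_lhs => rw [h2]
    simp
  have hAuq : aeval Au q = 0 := by
    have : aeval Au q = LinearMap.toMatrixAlgEquiv bV (aeval fV q) :=
      Polynomial.aeval_algHom_apply (LinearMap.toMatrixAlgEquiv bV).toAlgHom fV q
    have h0 : aeval fV q = 0 := LinearMap.ext (haeval q)
    rw [this, h0]
    exact map_zero (LinearMap.toMatrixAlgEquiv bV)
  have hAsq : aeval As q' = 0 := by
    have : aeval As q' = LinearMap.toMatrixAlgEquiv bW (aeval fW q') :=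
      Polynomial.aeval_algHom_apply (LinearMap.toMatrixAlgEquiv bW).toAlgHom fW q'
    have h0 : aeval fW q' = 0 := LinearMap.ext (haeval q')
    rw [this, h0]
    exact map_zero (LinearMap.toMatrixAlgEquiv bW)
  have hchar : A.charpoly = Au.charpoly * As.charpoly := by
    have h1 : (LinearMap.toMatrix bb bb f).charpoly = A.charpoly := by
      rw [LinearMap.charpoly_toMatrix]; simp [f]
    rw [← h1, hblock, charpoly_fromBlocks_zero₁₂]
  -- Multiplicities come from the factorization of the characteristic polynomial. As `q` annihilates
  -- `Au` and `q'` annihilates `As`, filtering by `p` then separates the two summands.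
  have hRsum : R = eigenvalues Au + eigenvalues As := by
    simp only [hR, eigenvalues, map_charpoly_eq]
    rw [hchar, Polynomial.map_mul, Polynomial.roots_mul]
    exact mul_ne_zero ((charpoly_monic _).map _).ne_zero ((charpoly_monic _).map _).ne_zero
  have hpu : ∀ z ∈ eigenvalues Au, p z := fun z hz =>
    hqroots z (isRoot_of_mem_eigenvalues_of_aeval_eq_zero hAuq hz)
  have hps : ∀ z ∈ eigenvalues As, ¬ p z := fun z hz =>
    hqroots' z (isRoot_of_mem_eigenvalues_of_aeval_eq_zero hAsq hz)
  refine ⟨_, _, Au, As, LinearMap.toMatrix B bb LinearMap.id,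
    LinearMap.toMatrix bb B LinearMap.id, ?_, ?_, ?_, ?_, ?_⟩
  · rw [← LinearMap.toMatrix_comp]; simp
  · rw [← LinearMap.toMatrix_comp]; simp
  · have hA : A = LinearMap.toMatrix B B f := by
      simp [f, B, LinearMap.toMatrix_eq_toMatrix']
    rw [← hblock, ← LinearMap.toMatrix_comp]
    conv_lhs => rw [hA]
    rw [← LinearMap.toMatrix_comp]
    rfl
  · rw [hRsum, Multiset.filter_add, Multiset.filter_eq_self.2 hpu,
      Multiset.filter_eq_nil.2 hps, add_zero]
  · rw [hRsum, Multiset.filter_add, Multiset.filter_eq_self.2 hps,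
      Multiset.filter_eq_nil.2 fun z hz => not_not.2 (hpu z hz), zero_add]

end Splitting

/-! ### Static feedback over an erasure channel for an antistable pair. -/

section StaticFeedback

variable {ι : Type*} [Fintype ι] [DecidableEq ι]

theorem det_add_vecMulVec {W : Matrix ι ι ℝ} (hW : IsUnit W.det) (u v : ι → ℝ) :
    (W + vecMulVec u v).det = W.det * (1 + v ⬝ᵥ W⁻¹ *ᵥ u) := by
  rw [vecMulVec_eq Unit, det_add_replicateCol_mul_replicateRow hW]
  congr 1
  rw [det_unique]
  simp [Matrix.mul_assoc, mul_apply, mulVec, dotProduct, Matrix.mul_assoc]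

/-- Sherman–Morrison. Since `H W Hᵀ = W + g gᵀ` for the Gramian below, it computes `Jᵀ W⁻¹ J`. -/
theorem mul_inv_rank_one {W : Matrix ι ι ℝ} (hW : W.PosDef) (g : ι → ℝ) :
    (W + vecMulVec g g) * (W⁻¹ - (1 + g ⬝ᵥ W⁻¹ *ᵥ g)⁻¹ • vecMulVec (W⁻¹ *ᵥ g) (W⁻¹ *ᵥ g)) = 1 := by
  have hu : IsUnit W.det := hW.det_pos.ne'.isUnit
  have hs : 0 ≤ g ⬝ᵥ W⁻¹ *ᵥ g := quad_nonneg hW.inv.posSemidef g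
  have hsym : W⁻¹ᵀ = W⁻¹ := symm_of_posSemidef hW.inv.posSemidef
  have h1 : W * vecMulVec (W⁻¹ *ᵥ g) (W⁻¹ *ᵥ g) = vecMulVec g (W⁻¹ *ᵥ g) := by
    rw [mul_vecMulVec, mulVec_mulVec, mul_nonsing_inv _ hu, one_mulVec]
  have h2 : vecMulVec g g * W⁻¹ = vecMulVec g (W⁻¹ *ᵥ g) := by
    rw [vecMulVec_mul, ← mulVec_transpose, hsym]
  have h3 : vecMulVec g g * vecMulVec (W⁻¹ *ᵥ g) (W⁻¹ *ᵥ g)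
      = (g ⬝ᵥ W⁻¹ *ᵥ g) • vecMulVec g (W⁻¹ *ᵥ g) := by
    rw [vecMulVec_mul_vecMulVec, vecMulVec_smul]
  rw [Matrix.mul_sub, Matrix.add_mul, mul_nonsing_inv _ hu, h2, Matrix.mul_smul, Matrix.add_mul,
    h1, h3, add_sub_assoc]
  set N := vecMulVec g (W⁻¹ *ᵥ g)
  set s := g ⬝ᵥ W⁻¹ *ᵥ g
  have h4 : N + s • N = (1 + s) • N := by rw [add_smul, one_smul]
  rw [h4, smul_smul, inv_mul_cancel₀ (by positivity), one_smul, sub_self, add_zero]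

/-- Mean-square stabilization of an antistable single-input pair over an erasure channel. -/
theorem exists_static_feedback {H J : Matrix ι ι ℝ} (hHJ : H * J = 1) (hJH : J * H = 1)
    {c r : ℝ} (hr : 0 ≤ r) (hr1 : r < 1) (hJ : ∀ k i j, |(J ^ k) i j| ≤ c * r ^ k) (g : ι → ℝ)
    (hg : ∀ v : ι → ℝ, (∀ k : ℕ, v ⬝ᵥ J ^ k *ᵥ (J *ᵥ g) = 0) → v = 0)
    {α : ℝ} (hα : α * H.det ^ 2 ≤ 1) :
    ∃ (P : Matrix ι ι ℝ) (F : ι → ℝ), P.PosDef ∧ ∀ x,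
      α * quad P (H *ᵥ x) + (1 - α) * quad P (H *ᵥ x + (F ⬝ᵥ x) • g) ≤ quad P x := by
  -- `W = ∑ J^k (J g)(J g)ᵀ (Jᵀ)^k` is the controllability Gramian in backward time; `hg` makes it
  -- positive definite.
  obtain ⟨W, hWs, hWe, hWq⟩ := exists_stein_solution (Z := Jᵀ) hr hr1
    (fun k i j => by rw [← transpose_pow]; exact hJ k j i)
    (vecMulVec (J *ᵥ g) (J *ᵥ g)) (by rw [transpose_vecMulVec])
  have hterm : ∀ k v, quad (vecMulVec (J *ᵥ g) (J *ᵥ g)) (Jᵀ ^ k *ᵥ v)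
      = (v ⬝ᵥ J ^ k *ᵥ (J *ᵥ g)) ^ 2 := fun k v => by
    rw [quad_vecMulVec, ← transpose_pow, mulVec_transpose, dotProduct_comm,
      ← dotProduct_mulVec]
  simp only [hterm] at hWq
  have hW : W.PosDef := by
    refine posDef_of_quad hWs fun v hv => lt_of_le_of_ne ((hWq v).nonneg fun k => sq_nonneg _) ?_
    intro h0
    refine hv (hg v fun k => ?_)
    have h1 := (hasSum_zero_iff_of_nonneg fun k => sq_nonneg _).1 (h0 ▸ hWq v)
    simpa using congrFun h1 k
  have hWu : IsUnit W.det := hW.det_pos.ne'.isUnit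
  have hHW : H * W * Hᵀ = W + vecMulVec g g := by
    conv_lhs => rw [hWe]
    have e1 : H * vecMulVec (J *ᵥ g) (J *ᵥ g) * Hᵀ = vecMulVec g g := by
      rw [mul_vecMulVec, vecMulVec_mul, vecMul_transpose, mulVec_mulVec, hHJ, one_mulVec]
    have e2 : H * (Jᵀᵀ * W * Jᵀ) * Hᵀ = W := by
      have : H * (Jᵀᵀ * W * Jᵀ) * Hᵀ = (H * J) * W * (H * J)ᵀ := by
        simp only [transpose_transpose, transpose_mul, Matrix.mul_assoc]
      rw [this, hHJ, transpose_one, Matrix.one_mul, Matrix.mul_one]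
    rw [Matrix.mul_add, Matrix.add_mul, e1, e2, add_comm]
  set P := W⁻¹ with hP
  have hPp : P.PosDef := hW.inv
  have hPs : Pᵀ = P := symm_of_posSemidef hPp.posSemidef
  set s := g ⬝ᵥ P *ᵥ g with hs
  have hs0 : 0 ≤ s := quad_nonneg hPp.posSemidef g
  -- Taking determinants in `H W Hᵀ = W + g gᵀ` converts the volume growth of `H` into the scalar
  -- `s`; this is how the product of eigenvalues enters the loss bound.
  have hdet : H.det ^ 2 = 1 + s := by
    have h1 := congrArg det hHW
    rw [det_mul, det_mul, det_transpose, det_add_vecMulVec hWu] at h1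
    have h2 : W.det * (H.det ^ 2) = W.det * (1 + s) := by rw [← h1]; ring
    exact mul_left_cancel₀ hW.det_pos.ne' h2
  have hN : Jᵀ * P * J = P - (1 + s)⁻¹ • vecMulVec (P *ᵥ g) (P *ᵥ g) := by
    have h1 := mul_inv_rank_one hW g
    rw [← hHW] at h1
    have h2 : (Jᵀ * P * J) * (H * W * Hᵀ) = 1 := by
      have : (Jᵀ * P * J) * (H * W * Hᵀ) = Jᵀ * (P * ((J * H) * W)) * Hᵀ := by
        simp only [Matrix.mul_assoc]
      rw [this, hJH, Matrix.one_mul, nonsing_inv_mul _ hWu, Matrix.mul_one, ← transpose_mul, hHJ,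
        transpose_one]
    exact left_inv_eq_right_inv h2 h1
  -- This gain minimizes `quad P (H x + u g)` over `u`. If `s = 0`, then `g = 0` and the convention
  -- `0⁻¹ = 0` gives the zero gain.
  refine ⟨P, -(s⁻¹) • ((P *ᵥ g) ᵥ* H), hPp, fun x => ?_⟩
  set y := H *ᵥ x with hy
  have hx : x = J *ᵥ y := by rw [hy, mulVec_mulVec, hJH, one_mulVec]
  set a := (P *ᵥ g) ⬝ᵥ y with ha
  have hF : (-(s⁻¹) • ((P *ᵥ g) ᵥ* H)) ⬝ᵥ x = -(s⁻¹) * a := by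
    rw [smul_dotProduct, ← dotProduct_mulVec, smul_eq_mul]
  have hqx : quad P x = quad P y - (1 + s)⁻¹ * a ^ 2 := by
    conv_lhs => rw [hx]
    rw [quad_mulVec, hN, sub_eq_add_neg, ← neg_smul, quad_add, quad_smul, quad_vecMulVec]
    ring
  have hya : y ⬝ᵥ P *ᵥ g = a := dotProduct_comm _ _
  rw [hF, hqx, quad_add_vec hPs, quad_smul_vec, mulVec_smul, dotProduct_smul, hya, smul_eq_mul]
  have hg' : quad P g = s := rfl
  rw [hg']
  rcases hs0.eq_or_lt with h0 | hpos
  · have hgz : g = 0 := by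
      by_contra hne
      exact (quad_pos hPp hne).ne' (hg'.trans h0.symm)
    have haz : a = 0 := by rw [ha, hgz]; simp
    rw [haz]; simp only [mul_zero, zero_mul, add_zero, zero_pow two_ne_zero, sub_zero]; linarith
  · have h1 : α * (1 + s) ≤ 1 := hdet ▸ hα
    -- With denominators cleared this is `α (1 + s) ≤ 1`.
    have h2 : (1 + s)⁻¹ ≤ (1 - α) * s⁻¹ := by
      rw [inv_eq_one_div, inv_eq_one_div, mul_one_div, div_le_div_iff₀ (by positivity) hpos]
      linarith
    have h3 := mul_le_mul_of_nonneg_right h2 (sq_nonneg a)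
    have h4 : 2 * (-s⁻¹ * a * a) + (-s⁻¹ * a) ^ 2 * s = -(s⁻¹ * a ^ 2) := by
      field_simp
      ring
    have h5 : quad P y + 2 * (-s⁻¹ * a * a) + (-s⁻¹ * a) ^ 2 * s = quad P y - s⁻¹ * a ^ 2 := by
      rw [add_assoc, h4]; ring
    rw [h5]
    linarith

end StaticFeedback

/-! ### Controllability under nonpathological sampling. -/

section Sampling

open Polynomial

variable {m : ℕ}

/-- Nonpathological sampling preserves controllability (in dual form). -/
theorem eq_zero_of_sampled_orthogonal {A Ai : Matrix (Fin m) (Fin m) ℝ} (hA : A * Ai = 1)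
    {d : ℕ} (hd : d ≠ 0)
    (hnp : ∀ z ∈ eigenvalues A, ∀ w ∈ eigenvalues A, z ^ d = w ^ d → z = w) (B : Fin m → ℝ)
    (hB : ∀ v : Fin m → ℝ, (∀ i : ℕ, v ⬝ᵥ A ^ i *ᵥ B = 0) → v = 0) (v : Fin m → ℝ)
    (hv : ∀ k : ℕ, v ⬝ᵥ (Ai ^ d) ^ k *ᵥ (Ai *ᵥ B) = 0) : v = 0 := by
  have hA' : Ai * A = 1 := mul_eq_one_comm.1 hA
  let toC : Matrix (Fin m) (Fin m) ℝ → Module.End ℂ (Fin m → ℂ) :=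
    fun M => toLin' (M.map (algebraMap ℝ ℂ))ᵀ
  let pair : (Fin m → ℂ) → (Fin m → ℝ) → ℂ := fun u w => u ⬝ᵥ (fun i => (w i : ℂ))
  have hpair : ∀ M u w, pair (toC M u) w = pair u (M *ᵥ w) := fun M u w => by
    simp only [pair, toC, toLin'_apply, mulVec_transpose]
    rw [← dotProduct_mulVec]
    congr 1
    ext i
    simp [mulVec, dotProduct]
  have htoC : ∀ M N, toC (M * N) = toC N * toC M := fun M N => by
    simp only [toC, Matrix.map_mul, transpose_mul]
    exact toLin'_mul _ _
  have htoC1 : toC 1 = 1 := by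
    simp only [toC, Matrix.map_one _ (map_zero _) (map_one _), transpose_one, toLin'_one]
    rfl
  have htoCp : ∀ M (k : ℕ), toC (M ^ k) = toC M ^ k := fun M k => by
    induction k with
    | zero => simpa using htoC1
    | succ k ih => rw [pow_succ, htoC, ih, pow_succ']
  set f := toC A with hf
  set fi := toC Ai with hfi
  have hffi : f * fi = 1 := by rw [hf, hfi, ← htoC, hA', htoC1]
  have hfif : fi * f = 1 := by rw [hf, hfi, ← htoC, hA, htoC1]
  -- The complex annihilator of the sampled vectors is invariant under `fi ^ d`. If nonzero it
  -- contains an eigenvector of `fi ^ d`, which will turn out to be an eigenvector of `f` itself and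
  -- to annihilate all `A ^ i B`.
  let K : Submodule ℂ (Fin m → ℂ) :=
    { carrier := {u | ∀ k : ℕ, pair u ((Ai ^ d) ^ k *ᵥ (Ai *ᵥ B)) = 0}
      zero_mem' := fun k => by simp [pair]
      add_mem' := fun {a b} ha hb k => by
        have h1 := ha k
        have h2 := hb k
        simp only [pair] at h1 h2 ⊢
        rw [add_dotProduct, h1, h2, add_zero]
      smul_mem' := fun c a ha k => by
        have h1 := ha k
        simp only [pair] at h1 ⊢
        rw [smul_dotProduct, h1, smul_zero] }
  have hKinv : ∀ u ∈ K, (fi ^ d) u ∈ K := fun u hu k => by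
    rw [hfi, ← htoCp, hpair, mulVec_mulVec, ← pow_succ']
    exact hu (k + 1)
  suffices hK : K = ⊥ by
    have hvK : (fun i => (v i : ℂ)) ∈ K := fun k => by
      have := congrArg (fun x : ℝ => (x : ℂ)) (hv k)
      simpa [pair, dotProduct] using this
    rw [hK, Submodule.mem_bot] at hvK
    ext i
    simpa using congrFun hvK i
  by_contra hne
  have : Nontrivial K := Submodule.nontrivial_iff_ne_bot.2 hne
  obtain ⟨ν, hν⟩ := Module.End.exists_eigenvalue ((fi ^ d).restrict hKinv)
  obtain ⟨⟨u, huK⟩, hu⟩ := hν.exists_hasEigenvector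
  have hu0 : u ≠ 0 := fun h => hu.2 (by ext1; exact h)
  have hfu : (fi ^ d) u = ν • u := congrArg Subtype.val hu.apply_eq_smul
  have hinv : f ^ d * fi ^ d = 1 := by
    rw [← (show Commute f fi from hffi.trans hfif.symm).mul_pow, hffi, one_pow]
  have hinv' : ν • (f ^ d) u = u := by
    have := congrArg (fun g : Module.End ℂ (Fin m → ℂ) => g u) hinv
    simp only [Module.End.mul_apply, Module.End.one_apply] at this
    rwa [hfu, map_smul] at this
  have hν0 : ν ≠ 0 := by
    rintro rfl
    exact hu0 (by rw [← hinv', zero_smul])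
  set μ := ν⁻¹ with hμ
  have hμ0 : μ ≠ 0 := inv_ne_zero hν0
  have hfd : (f ^ d) u = μ • u := by
    conv_rhs => rw [← hinv']
    rw [smul_smul, inv_mul_cancel₀ hν0, one_smul]
  set p : ℂ[X] := X ^ d - C μ with hp
  have hpu : aeval f p u = 0 := by
    simp [hp, hfd, Module.algebraMap_end_apply]
  have hchi : aeval f f.charpoly = 0 := f.aeval_self_charpoly
  have hcop : ∀ q : ℂ[X], (∀ z, q.IsRoot z → ¬ f.charpoly.IsRoot z) →
      ∀ w, aeval f q w = 0 → w = 0 := fun q hq w hw => by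
    have h1 : IsCoprime q f.charpoly := by
      refine (isCoprime_iff_aeval_ne_zero_of_isAlgClosed ℂ ℂ _ _).2 fun z => ?_
      by_contra! h
      simp only [coe_aeval_eq_eval] at h
      exact hq z h.1 h.2
    obtain ⟨a, b, hab⟩ := h1
    have h2 := congrArg (fun r => aeval f r w) hab
    simpa [hchi, hw] using h2.symm
  have heig : ∀ z, f.charpoly.IsRoot z ↔ z ∈ eigenvalues A := fun z => by
    rw [eigenvalues, mem_roots (charpoly_monic _).ne_zero]
    simp only [hf, toC, toLin'_apply', charpoly_mulVecLin, charpoly_transpose]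
  have hproot : ∀ z, p.IsRoot z ↔ z ^ d = μ := fun z => by
    simp [hp, IsRoot, sub_eq_zero]
  obtain ⟨l, hlp, hlf⟩ : ∃ z, p.IsRoot z ∧ f.charpoly.IsRoot z := by
    by_contra! h
    exact hu0 (hcop p h u hpu)
  have hl0 : l ≠ 0 := by
    rintro rfl
    exact hμ0 (by rw [← (hproot 0).1 hlp, zero_pow hd])
  obtain ⟨q, hq⟩ := dvd_iff_isRoot.2 hlp
  have hql : ¬ q.IsRoot l := by
    intro h
    have h1 : p.derivative.eval l = 0 := by
      rw [hq, derivative_mul]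
      simp [h.eq_zero]
    rw [hp, derivative_sub, derivative_X_pow, derivative_C] at h1
    simp [hd, hl0] at h1
  -- `p = X ^ d - μ` kills `u`, meets the spectrum only in `l` by nonpathological sampling, and has
  -- `l` as a simple root. So the cofactor `q` shares no root with the characteristic polynomial,
  -- `q(f)` is injective, and `(f - l) u = 0`.
  have hfl : f u = l • u := by
    have h1 : aeval f q (f u - l • u) = 0 := by
      have h2 : aeval f (X - C l) u = f u - l • u := by
        simp [Module.algebraMap_end_apply]
      rw [← h2, ← Module.End.mul_apply, ← map_mul, mul_comm, ← hq, hpu]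
    refine sub_eq_zero.1 (hcop q (fun z hz hz' => hql ?_) _ h1)
    have h3 : p.IsRoot z := by rw [hq]; exact root_mul_left_of_isRoot _ hz
    have : z = l := hnp z ((heig z).1 hz') l ((heig l).1 hlf)
      (((hproot z).1 h3).trans ((hproot l).1 hlp).symm)
    rwa [← this]
  have hpl : ∀ w, pair u (A *ᵥ w) = l * pair u w := fun w => by
    rw [← hpair, ← hf, hfl]
    simp only [pair]
    rw [smul_dotProduct, smul_eq_mul]
  have hB0 : pair u B = 0 := by
    have h1 : pair u (A *ᵥ (Ai *ᵥ B)) = 0 := by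
      rw [hpl, show pair u (Ai *ᵥ B) = 0 by simpa using huK 0, mul_zero]
    rwa [mulVec_mulVec, hA, one_mulVec] at h1
  have hBi : ∀ i : ℕ, pair u (A ^ i *ᵥ B) = 0 := fun i => by
    induction i with
    | zero => simpa using hB0
    | succ i ih => rw [pow_succ', ← mulVec_mulVec, hpl, ih, mul_zero]
  apply hu0
  have hre := hB (fun i => (u i).re) fun i => by
    have := congrArg Complex.re (hBi i)
    simpa [pair, dotProduct] using this
  have him := hB (fun i => (u i).im) fun i => by
    have := congrArg Complex.im (hBi i)
    simpa [pair, dotProduct] using this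
  ext i
  exact Complex.ext (congrFun hre i) (congrFun him i)

end Sampling

/-! ### Lyapunov certificates for the unstable and the stable block. -/

section Certificates

variable {m : ℕ}

theorem abs_det_eq_prod_norm_eigenvalues (A : Matrix (Fin m) (Fin m) ℝ) :
    |A.det| = ((eigenvalues A).map fun z => ‖z‖).prod := by
  have h1 : (A.map (algebraMap ℝ ℂ)).det = (A.det : ℂ) := by
    rw [← RingHom.mapMatrix_apply, ← RingHom.map_det]; rfl
  rw [det_eq_prod_roots_charpoly] at h1
  have h2 := congrArg (fun z => ‖z‖) h1
  simp only [Complex.norm_real, Real.norm_eq_abs] at h2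
  rw [← h2, eigenvalues]
  exact (map_multiset_prod (normHom : ℂ →*₀ ℝ) _)

theorem prod_map_pow_norm (s : Multiset ℂ) (k : ℕ) :
    (s.map fun z => ‖z‖ ^ k).prod = ((s.map fun z => ‖z‖).prod) ^ k := by
  rw [Multiset.prod_map_pow]

open Classical in
theorem unstableProd_eq_abs_det_pow {n : ℕ} {A : Matrix (Fin n) (Fin n) ℝ}
    {Au : Matrix (Fin m) (Fin m) ℝ}
    (h : eigenvalues Au = (eigenvalues A).filter fun z => 1 < ‖z‖) (k : ℕ) :
    unstableProd A k = |Au.det| ^ k := by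
  rw [unstableProd, prod_map_pow_norm, abs_det_eq_prod_norm_eigenvalues, h]

-- Eigenvalues of modulus one contribute the factor `1`, so stabilization may treat them together
-- with the unstable ones at no cost in the bound.
open Classical in
theorem unstableProd_eq_abs_det_pow' {n : ℕ} {A : Matrix (Fin n) (Fin n) ℝ}
    {Au : Matrix (Fin m) (Fin m) ℝ}
    (h : eigenvalues Au = (eigenvalues A).filter fun z => 1 ≤ ‖z‖) (k : ℕ) :
    unstableProd A k = |Au.det| ^ k := by
  rw [unstableProd, prod_map_pow_norm, abs_det_eq_prod_norm_eigenvalues, h]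
  congr 1
  have h1 : (eigenvalues A).filter (fun z => 1 < ‖z‖)
      = ((eigenvalues A).filter fun z => 1 ≤ ‖z‖).filter fun z => 1 < ‖z‖ := by
    rw [Multiset.filter_filter]
    exact Multiset.filter_congr fun z _ => ⟨fun h => ⟨h, h.le⟩, fun h => h.1⟩
  rw [h1]
  set s := (eigenvalues A).filter fun z => 1 ≤ ‖z‖ with hs
  have hsp : ∀ z ∈ s, 1 ≤ ‖z‖ := fun z hz => (Multiset.mem_filter.1 hz).2
  clear_value s
  clear h h1 hs
  induction s using Multiset.induction with
  | empty => simp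
  | cons a s ih =>
    have ih' := ih fun z hz => hsp z (Multiset.mem_cons_of_mem hz)
    by_cases ha : 1 < ‖a‖
    · rw [Multiset.filter_cons_of_pos (p := fun z : ℂ => 1 < ‖z‖) s ha, Multiset.map_cons, Multiset.prod_cons, ih',
        Multiset.map_cons, Multiset.prod_cons]
    · have : ‖a‖ = 1 := le_antisymm (not_lt.1 ha) (hsp a (Multiset.mem_cons_self a s))
      rw [Multiset.filter_cons_of_neg (p := fun z : ℂ => 1 < ‖z‖) s ha, Multiset.map_cons, Multiset.prod_cons, ih', this,
        one_mul]

theorem norm_le_one_of_mem_eigenvalues_inv {A Ai : Matrix (Fin m) (Fin m) ℝ} (hA : A * Ai = 1)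
    (h : ∀ z ∈ eigenvalues A, 1 ≤ ‖z‖) : ∀ z ∈ eigenvalues Ai, ‖z‖ ≤ 1 := by
  intro z hz
  have hA' : Ai * A = 1 := mul_eq_one_comm.1 hA
  let U : (Matrix (Fin m) (Fin m) ℂ)ˣ :=
    ⟨A.map (algebraMap ℝ ℂ), Ai.map (algebraMap ℝ ℂ),
      by rw [← Matrix.map_mul, hA]; simp, by rw [← Matrix.map_mul, hA']; simp⟩
  have hz' : z ∈ spectrum ℂ ((U⁻¹ : (Matrix (Fin m) (Fin m) ℂ)ˣ) : Matrix (Fin m) (Fin m) ℂ) :=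
    mem_eigenvalues_iff.1 hz
  have hz0 : z ≠ 0 := by
    rintro rfl
    exact spectrum.zero_notMem ℂ U⁻¹.isUnit hz'
  have h2 : z⁻¹ ∈ eigenvalues A := by
    refine mem_eigenvalues_iff.2 ?_
    exact (spectrum.inv₀_mem_iff (r := z) (a := U)).2 hz'
  have h3 := h _ h2
  rw [norm_inv] at h3
  exact (one_le_inv₀ (norm_pos_iff.2 hz0)).1 h3

/-- Distance from `k` to the next multiple of `d` (zero at multiples). -/
def phase (d k : ℕ) : ℕ := (d - 1) - (k + (d - 1)) % d

theorem phase_add (d k : ℕ) : phase d (k + d) = phase d k := by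
  unfold phase
  rw [show k + d + (d - 1) = k + (d - 1) + d by omega, Nat.add_mod_right]

theorem phase_of_dvd {d k : ℕ} (hd : d ≠ 0) (h : d ∣ k) :
    phase d k = 0 ∧ phase d (k + 1) = d - 1 := by
  obtain ⟨j, rfl⟩ := h
  unfold phase
  constructor
  · rw [Nat.mul_add_mod, Nat.mod_eq_of_lt (by omega), Nat.sub_self]
  · rw [show d * j + 1 + (d - 1) = d * (j + 1) by rw [mul_add]; omega, Nat.mul_mod_right,
      Nat.sub_zero]

theorem phase_of_not_dvd {d k : ℕ} (hd : d ≠ 0) (h : ¬ d ∣ k) :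
    phase d k = phase d (k + 1) + 1 := by
  have h0 : k % d ≠ 0 := fun h1 => h (Nat.dvd_of_mod_eq_zero h1)
  have h1 : k % d < d := Nat.mod_lt _ (by omega)
  have hk := Nat.div_add_mod k d
  set q := k / d
  set r := k % d
  unfold phase
  have e1 : (k + (d - 1)) % d = r - 1 := by
    rw [show k + (d - 1) = d * (q + 1) + (r - 1) by rw [mul_add]; omega, Nat.mul_add_mod,
      Nat.mod_eq_of_lt (by omega)]
  have e2 : (k + 1 + (d - 1)) % d = r := by
    rw [show k + 1 + (d - 1) = d * (q + 1) + r by rw [mul_add]; omega, Nat.mul_add_mod,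
      Nat.mod_eq_of_lt (by omega)]
  rw [e1, e2]
  omega

/-- The indicator of the multiples of `d`. -/
def pulse (d k : ℕ) : ℝ := if d ∣ k then 1 else 0

theorem pulse_eq_zero_or_one (d k : ℕ) : pulse d k = 0 ∨ pulse d k = 1 := by
  unfold pulse; split_ifs <;> simp

theorem pulse_add (d k : ℕ) : pulse d (k + d) = pulse d k := by
  simp [pulse]

/-- By continuity at `b = 1`, a strict loss bound tolerates a slight expansion of the plant, which
is later traded for a contraction rate. -/
theorem exists_scale {α D : ℝ} (h : α * D < 1) (k : ℕ) : ∃ b : ℝ, 1 < b ∧ α * (b ^ k * D) ≤ 1 := by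
  have hc : Filter.Tendsto (fun b : ℝ => α * (b ^ k * D)) (nhdsWithin 1 (Set.Ioi 1))
      (nhds (α * (1 ^ k * D))) := by
    have : Continuous fun b : ℝ => α * (b ^ k * D) := by fun_prop
    exact this.continuousAt.mono_left nhdsWithin_le_nhds
  rw [one_pow, one_mul] at hc
  obtain ⟨b, hb, hb'⟩ := ((hc.eventually_lt_const h).and self_mem_nhdsWithin).exists
  exact ⟨b, hb', hb.le⟩

/-- Periodic feedback certificate for a plant all of whose modes lie on or outside the unit
circle. -/
theorem exists_unstable_certificate (A : Matrix (Fin m) (Fin m) ℝ) (B : Fin m → ℝ)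
    (hB : ∀ v : Fin m → ℝ, (∀ i : ℕ, v ⬝ᵥ A ^ i *ᵥ B = 0) → v = 0)
    (h1 : ∀ z ∈ eigenvalues A, 1 ≤ ‖z‖) {d : ℕ} (hd : d ≠ 0)
    (hnp : ∀ z ∈ eigenvalues A, ∀ w ∈ eigenvalues A, z ^ d = w ^ d → z = w)
    {α : ℝ} (hα : α * |A.det| ^ (2 * d) < 1) :
    ∃ (F : Fin m → ℝ) (P : ℕ → Matrix (Fin m) (Fin m) ℝ) (ρ : ℝ), 0 < ρ ∧ ρ < 1 ∧
      (∀ k, (P k).PosDef) ∧ (∀ k, P (k + d) = P k) ∧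
      ∀ k x, α * quad (P (k + 1)) (A *ᵥ x)
        + (1 - α) * quad (P (k + 1)) (A *ᵥ x + (pulse d k * (F ⬝ᵥ x)) • B) ≤ ρ * quad (P k) x := by
  have hdet0 : IsUnit A.det := by
    rw [isUnit_iff_ne_zero, ← abs_ne_zero, abs_det_eq_prod_norm_eigenvalues]
    refine Multiset.prod_ne_zero fun h => ?_
    obtain ⟨z, hz, hz0⟩ := Multiset.mem_map.1 h
    have := h1 z hz
    rw [hz0] at this
    exact absurd this (by norm_num)
  obtain ⟨Ai, hAi⟩ : ∃ Ai, A * Ai = 1 := ⟨A⁻¹, mul_nonsing_inv A hdet0⟩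
  have hAi' : Ai * A = 1 := mul_eq_one_comm.1 hAi
  -- The exponent is the one in `det ((b A)^d)² = b^(2dm) (det A)^(2d)`. The scaling moves
  -- eigenvalues off the unit circle and yields the rate `b⁻²`.
  obtain ⟨b, hb1, hb⟩ := exists_scale hα (m * (2 * d))
  have hb0 : b ≠ 0 := by positivity
  -- `(1 + b) / 2` exceeds the spectral radius of `Ai`, which is at most one, and is below `b`; so
  -- the powers of `b⁻¹ Ai` decay.
  obtain ⟨c, hc, hdecay⟩ := exists_pow_entry_le Ai (R := (1 + b) / 2) (by positivity)
    fun z hz => (norm_le_one_of_mem_eigenvalues_inv hAi h1 z hz).trans_lt (by linarith)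
  set A' := b • A with hA'
  set J := (b⁻¹ • Ai) ^ d with hJ
  set H := A' ^ d with hH
  have hcomm : A' * (b⁻¹ • Ai) = 1 := by
    rw [hA', smul_mul_smul_comm, hAi, mul_inv_cancel₀ hb0, one_smul]
  have hcomm' : (b⁻¹ • Ai) * A' = 1 := mul_eq_one_comm.1 hcomm
  have hcm : Commute A' (b⁻¹ • Ai) := hcomm.trans hcomm'.symm
  have hHJ : H * J = 1 := by rw [hH, hJ, ← hcm.mul_pow, hcomm, one_pow]
  have hJH : J * H = 1 := mul_eq_one_comm.1 hHJ
  have hq0 : 0 ≤ (b⁻¹ * ((1 + b) / 2)) := by positivity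
  have hq1 : (b⁻¹ * ((1 + b) / 2)) < 1 := by
    rw [inv_mul_lt_iff₀ (by positivity)]; linarith
  have hJd : ∀ k i j, |(J ^ k) i j| ≤ c * ((b⁻¹ * ((1 + b) / 2)) ^ d) ^ k := fun k i j => by
    rw [hJ, ← pow_mul, ← pow_mul, smul_pow, Matrix.smul_apply, smul_eq_mul, abs_mul, abs_pow,
      abs_inv, abs_of_pos (by positivity : 0 < b), mul_pow]
    calc b⁻¹ ^ (d * k) * |(Ai ^ (d * k)) i j| ≤ b⁻¹ ^ (d * k) * (c * ((1 + b) / 2) ^ (d * k)) := by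
          gcongr
          exact hdecay _ _ _
      _ = _ := by ring
  have hJg : J *ᵥ (A' ^ (d - 1) *ᵥ B) = b⁻¹ • (Ai *ᵥ B) := by
    rw [hJ, mulVec_mulVec, ← smul_mulVec]
    congr 1
    obtain ⟨e, rfl⟩ := Nat.exists_eq_succ_of_ne_zero hd
    rw [Nat.succ_eq_add_one, Nat.add_sub_cancel, pow_succ', Matrix.mul_assoc, ← hcm.symm.mul_pow,
      hcomm', one_pow, Matrix.mul_one]
  obtain ⟨P, F, hP, hF⟩ := exists_static_feedback hHJ hJH (pow_nonneg hq0 d)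
    (pow_lt_one₀ hq0 hq1 hd) hJd (A' ^ (d - 1) *ᵥ B)
    (fun v hv => eq_zero_of_sampled_orthogonal hAi hd hnp B hB v fun k => by
      have h2 := hv k
      rw [hJg, hJ, smul_pow, smul_pow, mulVec_smul, smul_mulVec, dotProduct_smul,
        dotProduct_smul, smul_eq_mul, smul_eq_mul] at h2
      simpa [hb0] using h2)
    (α := α) (by
      have e : H.det ^ 2 = b ^ (m * (2 * d)) * |A.det| ^ (2 * d) := by
        rw [hH, det_pow, hA', det_smul, Fintype.card_fin, pow_mul |A.det|, sq_abs]
        ring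
      rw [e]; exact hb)
  -- The form at time `k` is `P` at the state carried without input to the next sampling instant.
  -- Unsampled steps then only rescale, and a sampled step is the static problem for `H` and `g = A'
  -- ^ (d - 1) B`. The factor `b⁻¹` in the gain offsets the rescaling of the step.
  refine ⟨b⁻¹ • F, fun k => (A' ^ phase d k)ᵀ * P * A' ^ phase d k, (b ^ 2)⁻¹, by positivity,
    inv_lt_one_of_one_lt₀ (one_lt_pow₀ hb1 two_ne_zero), fun k => posDef_conj hP fun x hx => ?_,
    fun k => ?_, fun k x => ?_⟩
  · have e : (b⁻¹ • Ai) ^ phase d k * A' ^ phase d k = 1 := by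
      rw [← hcm.symm.mul_pow, hcomm', one_pow]
    rw [← one_mulVec x, ← e, ← mulVec_mulVec, hx, mulVec_zero]
  · simp only [phase_add]
  · simp only [← quad_mulVec]
    rw [inv_mul_eq_div, le_div_iff₀ (by positivity)]
    have hsc : ∀ w : Fin m → ℝ, ∀ e : ℕ,
        quad P (A' ^ e *ᵥ w) * b ^ 2 = quad P (A' ^ e *ᵥ (b • w)) := fun w e => by
      rw [mulVec_smul, quad_smul_vec, mul_comm]
    rw [add_mul, mul_assoc, mul_assoc, hsc, hsc, smul_add, ← smul_mulVec, ← hA']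
    by_cases hk : d ∣ k
    · obtain ⟨e1, e2⟩ := phase_of_dvd hd hk
      have e3 : A' ^ (d - 1) * A' = H := by
        rw [← pow_succ, Nat.sub_add_cancel (Nat.one_le_iff_ne_zero.2 hd)]
      rw [e1, e2, pow_zero, one_mulVec, mulVec_add, mulVec_mulVec, e3, mulVec_smul, mulVec_smul,
        smul_smul, pulse, if_pos hk, one_mul, smul_dotProduct, smul_eq_mul,
        mul_inv_cancel_left₀ hb0]
      exact hF x
    · rw [phase_of_not_dvd hd hk, pulse, if_neg hk, zero_mul, zero_smul, smul_zero, add_zero,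
        mulVec_mulVec, ← pow_succ]
      linarith

/-- Lyapunov certificate for a stable matrix. -/
theorem exists_stable_certificate (A : Matrix (Fin m) (Fin m) ℝ)
    (h : ∀ z ∈ eigenvalues A, ‖z‖ < 1) :
    ∃ (P : Matrix (Fin m) (Fin m) ℝ) (ρ : ℝ), 0 < ρ ∧ ρ < 1 ∧ P.PosDef ∧
      ∀ x, quad P (A *ᵥ x) ≤ ρ * quad P x := by
  obtain ⟨R, hR0, hR1, hR⟩ : ∃ R : ℝ, 0 < R ∧ R < 1 ∧ ∀ z ∈ eigenvalues A, ‖z‖ < R := by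
    generalize eigenvalues A = s at h
    induction s using Multiset.induction with
    | empty => exact ⟨1 / 2, by norm_num, by norm_num, by simp⟩
    | cons a s ih =>
      obtain ⟨R, h0, h1, h2⟩ := ih fun z hz => h z (Multiset.mem_cons_of_mem hz)
      have ha := h a (Multiset.mem_cons_self a s)
      obtain ⟨R', h3, h4⟩ := exists_between (max_lt h1 ha)
      refine ⟨R', h0.trans ((le_max_left _ _).trans_lt h3), h4, fun z hz => ?_⟩
      rcases Multiset.mem_cons.1 hz with rfl | hz
      · exact (le_max_right _ _).trans_lt h3
      · exact (h2 z hz).trans ((le_max_left _ _).trans_lt h3)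
  obtain ⟨c, hc, hdecay⟩ := exists_pow_entry_le A hR0 hR
  -- Powers of `q⁻¹ A` still decay because `R < q`; the Stein equation for `q⁻¹ A` gives the rate
  -- `q² < 1`.
  obtain ⟨q, hq0, hq1⟩ := exists_between hR1
  have hqp : 0 < q := hR0.trans hq0
  obtain ⟨P, hPs, hPe, hPq⟩ := exists_stein_solution (Z := q⁻¹ • A) (c := c) (r := q⁻¹ * R)
    (by positivity) (by rwa [inv_mul_lt_iff₀ hqp, mul_one]) (fun k i j => by
      rw [smul_pow, Matrix.smul_apply, smul_eq_mul, abs_mul, abs_pow, abs_inv, abs_of_pos hqp,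
        mul_pow]
      calc q⁻¹ ^ k * |(A ^ k) i j| ≤ q⁻¹ ^ k * (c * R ^ k) := by
            gcongr
            exact hdecay _ _ _
        _ = _ := by ring) 1 transpose_one
  have hstep : ∀ x, quad P x = quad 1 x + (q⁻¹) ^ 2 * quad P (A *ᵥ x) := fun x => by
    conv_lhs => rw [hPe]
    rw [quad_add, ← quad_mulVec, smul_mulVec, quad_smul_vec]
  have hnn : ∀ x, 0 ≤ quad P x := fun x => (hPq x).nonneg fun k => quad_nonneg PosSemidef.one _
  refine ⟨P, q ^ 2, by positivity, by nlinarith, posDef_of_quad hPs fun x hx => ?_, fun x => ?_⟩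
  · rw [hstep]
    have h1 := quad_pos PosDef.one hx
    have h2 := mul_nonneg (sq_nonneg q⁻¹) (hnn (A *ᵥ x))
    linarith
  · rw [hstep x]
    have h1 : 0 ≤ quad 1 x := quad_nonneg PosSemidef.one x
    have h2 : q ^ 2 * (quad 1 x + q⁻¹ ^ 2 * quad P (A *ᵥ x))
        = q ^ 2 * quad 1 x + quad P (A *ᵥ x) := by
      field_simp
    rw [h2]
    nlinarith [sq_nonneg q]

end Certificates

/-! ### Gluing the stable and unstable blocks. -/

section Stabilization

/-- A form with a contraction certificate, driven through a second variable. -/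
theorem exists_coupled_bound {ι κ κ' σ : Type*} [Fintype ι] [Fintype κ] [Fintype κ'] [Fintype σ]
    {p : σ → ℝ} (hp : ∀ s, 0 ≤ p s) {P₁ : Matrix ι ι ℝ} (hP₁ : P₁.PosDef)
    {P₂ : Matrix κ κ ℝ} (hP₂ : P₂.PosSemidef) {P₂' : Matrix κ' κ' ℝ} (hP₂' : P₂'.PosSemidef)
    {ρ ρ' : ℝ} (hρ : 0 ≤ ρ) (hρρ' : ρ < ρ') (Φ : σ → Matrix κ' κ ℝ) (Γ : σ → Matrix κ' ι ℝ)
    (h : ∀ y, ∑ s, p s * quad P₂' (Φ s *ᵥ y) ≤ ρ * quad P₂ y) :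
    ∃ C : ℝ, 0 < C ∧ ∀ x y,
      ∑ s, p s * quad P₂' (Γ s *ᵥ x + Φ s *ᵥ y) ≤ C * quad P₁ x + ρ' * quad P₂ y := by
  -- Chosen so that the factor from Young's inequality keeps `(1 + ε) ρ ≤ ρ'`, also when `ρ = 0`.
  set ε := (ρ' - ρ) / (ρ + 1) with hε
  have hε0 : 0 < ε := div_pos (sub_pos.2 hρρ') (by linarith)
  have hε1 : (1 + ε) * ρ ≤ ρ' := by
    have h1 : ε * (ρ + 1) = ρ' - ρ := div_mul_cancel₀ _ (by linarith)
    linarith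
  obtain ⟨C, hC, hCx⟩ := exists_quad_le hP₁ (∑ s, p s • ((Γ s)ᵀ * P₂' * Γ s))
  refine ⟨(1 + ε⁻¹) * C, by positivity, fun x y => ?_⟩
  have h1 : ∑ s, p s * quad P₂' (Γ s *ᵥ x) ≤ C * quad P₁ x := by
    refine le_trans (le_of_eq ?_) (hCx x)
    rw [quad_sum]
    exact Finset.sum_congr rfl fun s _ => by rw [quad_smul, quad_mulVec]
  calc ∑ s, p s * quad P₂' (Γ s *ᵥ x + Φ s *ᵥ y)
      ≤ ∑ s, ((1 + ε⁻¹) * (p s * quad P₂' (Γ s *ᵥ x)) + (1 + ε) * (p s * quad P₂' (Φ s *ᵥ y))) :=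
        Finset.sum_le_sum fun s _ => by
          have := mul_le_mul_of_nonneg_left (quad_add_le hP₂' hε0 (Γ s *ᵥ x) (Φ s *ᵥ y)) (hp s)
          linarith
    _ = (1 + ε⁻¹) * ∑ s, p s * quad P₂' (Γ s *ᵥ x)
          + (1 + ε) * ∑ s, p s * quad P₂' (Φ s *ᵥ y) := by
        rw [Finset.sum_add_distrib, Finset.mul_sum, Finset.mul_sum]
    _ ≤ (1 + ε⁻¹) * (C * quad P₁ x) + (1 + ε) * (ρ * quad P₂ y) := by
        gcongr
        exact h y
    _ ≤ (1 + ε⁻¹) * C * quad P₁ x + ρ' * quad P₂ y := by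
        have := mul_le_mul_of_nonneg_right hε1 (quad_nonneg hP₂ y)
        linarith

/-- A family of constants for a periodic family of conditions can be chosen uniformly. -/
theorem exists_uniform_of_periodic {d : ℕ} (hd : d ≠ 0) {q : ℕ → ℝ → Prop}
    (hmono : ∀ k C C', q k C → C ≤ C' → q k C') (hper : ∀ k C, q (k + d) C ↔ q k C)
    (h : ∀ k, ∃ C, 0 < C ∧ q k C) : ∃ C, 0 < C ∧ ∀ k, q k C := by
  choose C hC0 hC using h
  have hsum : ∀ k < d, C k ≤ ∑ i ∈ Finset.range d, C i := fun k hk =>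
    Finset.single_le_sum (f := C) (fun i _ => (hC0 i).le) (Finset.mem_range.2 hk)
  refine ⟨∑ i ∈ Finset.range d, C i, (hC0 0).trans_le (hsum 0 (Nat.pos_of_ne_zero hd)),
    fun k => ?_⟩
  have hP : Function.Periodic (fun k => q k (∑ i ∈ Finset.range d, C i)) d := fun k =>
    propext (hper k _)
  have hlt := Nat.mod_lt k (Nat.pos_of_ne_zero hd)
  have h1 := hmono _ _ _ (hC (k % d)) (hsum _ hlt)
  exact (hP.map_mod_nat k).mp h1

variable {n : ℕ}

theorem quad_fromBlocks {ι κ : Type*} [Fintype ι] [Fintype κ] (M : Matrix ι ι ℝ)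
    (N : Matrix κ κ ℝ) (w : ι ⊕ κ → ℝ) :
    quad (fromBlocks M 0 0 N) w = quad M (w ∘ Sum.inl) + quad N (w ∘ Sum.inr) := by
  simp [quad, fromBlocks_mulVec, dotProduct]

/-- Mean-square stabilization over a periodically sampled erasure channel, with a periodic
quadratic certificate. -/
theorem exists_certificate (A : Matrix (Fin n) (Fin n) ℝ) (B : Fin n → ℝ)
    (hB : ∀ v : Fin n → ℝ, (∀ i : ℕ, v ⬝ᵥ A ^ i *ᵥ B = 0) → v = 0) {d : ℕ} (hd : d ≠ 0)
    (hnp : Nonpathological A d) {α : ℝ} (hα0 : 0 ≤ α) (hα1 : α ≤ 1)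
    (hα : α * unstableProd A (2 * d) < 1) :
    ∃ (F : Fin n → ℝ) (P : ℕ → Matrix (Fin n) (Fin n) ℝ) (ρ : ℝ), 0 < ρ ∧ ρ < 1 ∧
      (∀ k, (P k).PosDef) ∧ (∀ k, P (k + d) = P k) ∧
      ∀ k x, α * quad (P (k + 1)) (A *ᵥ x)
        + (1 - α) * quad (P (k + 1)) (A *ᵥ x + (pulse d k * (F ⬝ᵥ x)) • B) ≤ ρ * quad (P k) x := by
  classical
  -- Unit-circle modes join the unstable block, since the other block must have a strict Lyapunov
  -- form.
  obtain ⟨a, b, Au, As, T, S, hST, hTS, hTA, hu, hs⟩ :=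
    exists_spectral_splitting A (fun z => 1 ≤ ‖z‖) (by simp)
  have hup : ∀ z ∈ eigenvalues Au, z ∈ eigenvalues A ∧ 1 ≤ ‖z‖ := fun z hz =>
    Multiset.mem_filter.1 (hu ▸ hz)
  have hsp : ∀ z ∈ eigenvalues As, ‖z‖ < 1 := fun z hz => by
    rw [hs] at hz
    exact not_le.1 (Multiset.mem_filter.1 hz).2
  set D := fromBlocks Au 0 0 As with hD
  have hTApow : ∀ i : ℕ, T * A ^ i = D ^ i * T := fun i => by
    induction i with
    | zero => simp
    | succ i ih => rw [pow_succ, ← Matrix.mul_assoc, ih, Matrix.mul_assoc, hTA, pow_succ,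
        Matrix.mul_assoc]
  set Bu : Fin a → ℝ := (T *ᵥ B) ∘ Sum.inl with hBu
  set Bs : Fin b → ℝ := (T *ᵥ B) ∘ Sum.inr with hBs
  have hctrl : ∀ v : Fin a → ℝ, (∀ i : ℕ, v ⬝ᵥ Au ^ i *ᵥ Bu = 0) → v = 0 := fun v hv => by
    have h1 : (Sum.elim v 0 : Fin a ⊕ Fin b → ℝ) ᵥ* T = 0 := hB _ fun i => by
      rw [← dotProduct_mulVec, mulVec_mulVec, hTApow, ← mulVec_mulVec, hD, fromBlocks_diagonal_pow,
        fromBlocks_mulVec]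
      simpa [dotProduct, hBu] using hv i
    have h2 := congrArg (fun w => w ᵥ* S) h1
    simp only [vecMul_vecMul, hTS, vecMul_one, zero_vecMul] at h2
    ext i
    exact congrFun h2 (Sum.inl i)
  obtain ⟨Fu, Pu, ρu, hρu0, hρu1, hPu, hPuper, hFu⟩ := exists_unstable_certificate Au Bu hctrl
    (fun z hz => (hup z hz).2) hd
    (fun z hz w hw => hnp z (hup z hz).1 w (hup w hw).1 (hup z hz).2)
    (α := α) (by rwa [← unstableProd_eq_abs_det_pow' hu])
  obtain ⟨Ps, ρs, hρs0, hρs1, hPs, hPsd⟩ := exists_stable_certificate As hsp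
  obtain ⟨ρ, hρ, hρ1⟩ := exists_between (max_lt hρu1 hρs1)
  have hρu : ρu < ρ := (le_max_left _ _).trans_lt hρ
  have hρs : ρs < ρ := (le_max_right _ _).trans_lt hρ
  obtain ⟨C, hC0, hC⟩ : ∃ C : ℝ, 0 < C ∧ ∀ k, ∀ x y, α * quad Ps (As *ᵥ y)
      + (1 - α) * quad Ps (As *ᵥ y + (pulse d k * (Fu ⬝ᵥ x)) • Bs)
        ≤ C * quad (Pu k) x + ρ * quad Ps y := by
    refine exists_uniform_of_periodic hd (fun k C C' h hCC' x y => (h x y).trans ?_)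
      (fun k C => by rw [hPuper, pulse_add]) fun k => ?_
    · have := mul_le_mul_of_nonneg_right hCC' (quad_nonneg (hPu k).posSemidef x)
      linarith
    · obtain ⟨C, hC0, hC⟩ := exists_coupled_bound (σ := Fin 2) (p := ![α, 1 - α])
        (fun s => by fin_cases s <;> simp [hα0, hα1]) (hPu k) hPs.posSemidef hPs.posSemidef
        hρs0.le hρs (fun _ => As) ![0, pulse d k • vecMulVec Bs Fu] (fun y => by
          simp only [Fin.sum_univ_two, cons_val_zero, cons_val_one]
          linarith [hPsd y])
      refine ⟨C, hC0, fun x y => le_trans (le_of_eq ?_) (hC x y)⟩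
      simp only [Fin.sum_univ_two, cons_val_zero, cons_val_one, zero_mulVec, zero_add, smul_mulVec,
        vecMulVec_mulVec, op_smul_eq_smul, smul_smul]
      rw [add_comm (As *ᵥ y)]
  -- The feedback reads only the unstable coordinates, which drive the stable ones with cost `C`;
  -- with this weight the slack `c (ρ - ρu)` of the unstable form pays for it exactly.
  set c := C / (ρ - ρu) with hc
  have hc0 : 0 < c := div_pos hC0 (sub_pos.2 hρu)
  have hcC : c * ρu + C = ρ * c := by
    have : c * (ρ - ρu) = C := div_mul_cancel₀ _ (sub_pos.2 hρu).ne'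
    linarith
  have hquad : ∀ k x, quad (Tᵀ * fromBlocks (c • Pu k) 0 0 Ps * T) x
      = c * quad (Pu k) ((T *ᵥ x) ∘ Sum.inl) + quad Ps ((T *ᵥ x) ∘ Sum.inr) := fun k x => by
    rw [← quad_mulVec, quad_fromBlocks, quad_smul]
  refine ⟨(Sum.elim Fu 0 : Fin a ⊕ Fin b → ℝ) ᵥ* T,
    fun k => Tᵀ * fromBlocks (c • Pu k) 0 0 Ps * T, ρ, hρu0.trans hρu, hρ1, fun k => ?_,
    fun k => by simp only [hPuper], fun k x => ?_⟩
  · refine posDef_conj (posDef_of_quad ?_ fun w hw => ?_) fun x hx => ?_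
    · simp [fromBlocks_transpose, symm_of_posSemidef (hPu k).posSemidef,
        symm_of_posSemidef hPs.posSemidef]
    · rw [quad_fromBlocks, quad_smul]
      have h1 := quad_nonneg (hPu k).posSemidef (w ∘ Sum.inl)
      have h2 := quad_nonneg hPs.posSemidef (w ∘ Sum.inr)
      by_cases hw1 : w ∘ Sum.inl = 0
      · have hw2 : w ∘ Sum.inr ≠ 0 := fun hw2 => hw (by
          ext i
          rcases i with i | i
          · exact congrFun hw1 i
          · exact congrFun hw2 i)
        have := quad_pos hPs hw2
        positivity
      · have := quad_pos (hPu k) hw1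
        positivity
    · rw [← one_mulVec x, ← hST, ← mulVec_mulVec, hx, mulVec_zero]
  · have hTAx : T *ᵥ (A *ᵥ x) = D *ᵥ (T *ᵥ x) := by rw [mulVec_mulVec, hTA, ← mulVec_mulVec]
    set xu := (T *ᵥ x) ∘ Sum.inl with hxu
    set xs := (T *ᵥ x) ∘ Sum.inr with hxs
    have hl : (T *ᵥ (A *ᵥ x)) ∘ Sum.inl = Au *ᵥ xu := by
      rw [hTAx, hD, fromBlocks_mulVec]; simp [hxu]
    have hr : (T *ᵥ (A *ᵥ x)) ∘ Sum.inr = As *ᵥ xs := by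
      rw [hTAx, hD, fromBlocks_mulVec]; simp [hxs]
    have hF : ((Sum.elim Fu 0 : Fin a ⊕ Fin b → ℝ) ᵥ* T) ⬝ᵥ x = Fu ⬝ᵥ xu := by
      rw [← dotProduct_mulVec]
      simp [dotProduct, hxu]
    rw [hF, hquad, hquad, hquad, mulVec_add, mulVec_smul]
    have hl' : ∀ t : ℝ, (T *ᵥ (A *ᵥ x) + t • T *ᵥ B) ∘ Sum.inl = Au *ᵥ xu + t • Bu := fun t => by
      rw [← hl]; rfl
    have hr' : ∀ t : ℝ, (T *ᵥ (A *ᵥ x) + t • T *ᵥ B) ∘ Sum.inr = As *ᵥ xs + t • Bs := fun t => by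
      rw [← hr]; rfl
    rw [hl, hr, hl', hr']
    have h1 := mul_le_mul_of_nonneg_left (hFu k xu) hc0.le
    have h2 := hC k xu xs
    have h3 : (c * ρu + C) * quad (Pu k) xu = ρ * c * quad (Pu k) xu := by rw [hcC]
    linarith

end Stabilization

/-! ### Second-moment recursions and their adjoints. -/

section SecondMoments

variable {ι σ : Type*} [Fintype ι] [Fintype σ]

/-- Propagation of second moments through a random matrix `Φ` with weights `w`. -/
def kraus (w : σ → ℝ) (Φ : σ → Matrix ι ι ℝ) (M : Matrix ι ι ℝ) : Matrix ι ι ℝ :=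
  ∑ s, w s • (Φ s * M * (Φ s)ᵀ)

/-- Second moments along a sequence of independent random matrices. -/
def moment (w : σ → ℝ) (Φ : ℕ → σ → Matrix ι ι ℝ) (M : Matrix ι ι ℝ) : ℕ → Matrix ι ι ℝ
  | 0 => M
  | k + 1 => kraus w (Φ k) (moment w Φ M k)

/-- The adjoint of `moment` with respect to the trace pairing. -/
def adjMoment (w : σ → ℝ) (Φ : ℕ → σ → Matrix ι ι ℝ) : ℕ → Matrix ι ι ℝ → Matrix ι ι ℝ
  | 0, Q => Q
  | k + 1, Q => adjMoment w Φ k (kraus w (fun s => (Φ k s)ᵀ) Q)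

theorem quad_kraus (w : σ → ℝ) (Φ : σ → Matrix ι ι ℝ) (M : Matrix ι ι ℝ) (x : ι → ℝ) :
    quad (kraus w Φ M) x = ∑ s, w s * quad M ((Φ s)ᵀ *ᵥ x) := by
  simp only [kraus, quad_sum, quad_smul, quad_mulVec, transpose_transpose]

theorem posSemidef_kraus {w : σ → ℝ} (hw : ∀ s, 0 ≤ w s) (Φ : σ → Matrix ι ι ℝ)
    {M : Matrix ι ι ℝ} (hM : M.PosSemidef) : (kraus w Φ M).PosSemidef :=
  posSemidef_sum _ fun s _ => (posSemidef_conj' hM _).smul (hw s)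

theorem posSemidef_moment {w : σ → ℝ} (hw : ∀ s, 0 ≤ w s) (Φ : ℕ → σ → Matrix ι ι ℝ)
    {M : Matrix ι ι ℝ} (hM : M.PosSemidef) (k : ℕ) : (moment w Φ M k).PosSemidef := by
  induction k with
  | zero => exact hM
  | succ k ih => exact posSemidef_kraus hw _ ih

theorem posSemidef_adjMoment {w : σ → ℝ} (hw : ∀ s, 0 ≤ w s) (Φ : ℕ → σ → Matrix ι ι ℝ) (k : ℕ)
    {Q : Matrix ι ι ℝ} (hQ : Q.PosSemidef) : (adjMoment w Φ k Q).PosSemidef := by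
  induction k generalizing Q with
  | zero => exact hQ
  | succ k ih => exact ih (posSemidef_kraus hw _ hQ)

theorem trace_mul_kraus (w : σ → ℝ) (Φ : σ → Matrix ι ι ℝ) (Q M : Matrix ι ι ℝ) :
    (Q * kraus w Φ M).trace = ∑ s, w s * ((Φ s)ᵀ * Q * Φ s * M).trace := by
  simp only [kraus, Matrix.mul_sum, trace_sum, Matrix.mul_smul, trace_smul, smul_eq_mul]
  refine Finset.sum_congr rfl fun s _ => ?_
  rw [← Matrix.mul_assoc, ← Matrix.mul_assoc, trace_mul_comm, ← Matrix.mul_assoc,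
    ← Matrix.mul_assoc]

theorem trace_kraus_transpose_mul (w : σ → ℝ) (Φ : σ → Matrix ι ι ℝ) (Q M : Matrix ι ι ℝ) :
    (kraus w (fun s => (Φ s)ᵀ) Q * M).trace = (Q * kraus w Φ M).trace := by
  rw [trace_mul_kraus]
  simp [kraus, Matrix.sum_mul, trace_sum]

/-- Duality: for `Q = M = 1` the two traces agree, so decay passes to the transposed recursion,
where state feedback `B F` looks like output injection. -/
theorem trace_adjMoment_mul (w : σ → ℝ) (Φ : ℕ → σ → Matrix ι ι ℝ) (k : ℕ) (Q M : Matrix ι ι ℝ) :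
    (adjMoment w Φ k Q * M).trace = (Q * moment w Φ M k).trace := by
  induction k generalizing Q with
  | zero => rfl
  | succ k ih => rw [adjMoment, ih, trace_kraus_transpose_mul, moment]

theorem kraus_sum {τ : Type*} (S : Finset τ) (w : σ → ℝ) (Φ : σ → Matrix ι ι ℝ)
    (M : τ → Matrix ι ι ℝ) : kraus w Φ (∑ i ∈ S, M i) = ∑ i ∈ S, kraus w Φ (M i) := by
  simp only [kraus, Matrix.mul_sum, Matrix.sum_mul, Finset.smul_sum]
  exact Finset.sum_comm

theorem moment_sum {τ : Type*} (S : Finset τ) (w : σ → ℝ) (Φ : ℕ → σ → Matrix ι ι ℝ)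
    (M : τ → Matrix ι ι ℝ) (k : ℕ) :
    moment w Φ (∑ i ∈ S, M i) k = ∑ i ∈ S, moment w Φ (M i) k := by
  induction k with
  | zero => rfl
  | succ k ih => simp only [moment, ih, kraus_sum]

/-- Positivity on `eᵢ ± eⱼ` bounds an entry by the mean of two diagonal entries. -/
theorem abs_entry_le_trace {M : Matrix ι ι ℝ} (hM : M.PosSemidef) (i j : ι) :
    |M i j| ≤ M.trace := by
  classical
  have hs := symm_of_posSemidef hM
  have hd : ∀ k, M k k ≤ M.trace := fun k =>
    Finset.single_le_sum (f := fun k => M k k) (fun k _ => hM.diag_nonneg) (Finset.mem_univ k)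
  have e : ∀ k l, Pi.single k 1 ⬝ᵥ M *ᵥ Pi.single l (1 : ℝ) = M k l := fun k l => by simp
  have e' : ∀ k, quad M (Pi.single k 1) = M k k := fun k => e k k
  have h1 := quad_nonneg hM (Pi.single i 1 + Pi.single j 1)
  have h2 := quad_nonneg hM (Pi.single i 1 + (-1 : ℝ) • Pi.single j 1)
  rw [quad_add_vec hs, e', e', e] at h1
  rw [quad_add_vec hs, quad_smul_vec, mulVec_smul, dotProduct_smul, e', e', e, smul_eq_mul] at h2
  have h3 := hd i
  have h4 := hd j
  rw [abs_le]
  constructor <;> linarith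

end SecondMoments

/-! ### Necessary loss bounds from determinants of compressed moments. -/

section DeterminantBound

variable {σ : Type*} [Fintype σ] {a n : ℕ}

theorem posDef_of_posSemidef_of_det_ne_zero {G : Matrix (Fin a) (Fin a) ℝ} (hG : G.PosSemidef)
    (h : G.det ≠ 0) : G.PosDef := by
  refine posDef_of_quad (symm_of_posSemidef hG) fun x hx => lt_of_le_of_ne (quad_nonneg hG x) ?_
  intro h0
  have h1 : G *ᵥ x = 0 := by
    have := (hG.dotProduct_mulVec_zero_iff x).1 (by simpa [quad] using h0.symm)
    exact this
  exact hx (eq_zero_of_mulVec_eq_zero h h1)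

/-- One step of the estimation error: an observation that arrives with probability `1 - α` can
shrink the determinant of the second moment at most by the factor `α`. -/
theorem det_kraus_ge {w : σ → ℝ} (hw : ∀ s, 0 ≤ w s) (hw1 : ∑ s, w s = 1) {t : σ → ℝ}
    (ht : ∀ s, t s = 0 ∨ t s = 1) {A : Matrix (Fin n) (Fin n) ℝ} {Au : Matrix (Fin a) (Fin a) ℝ}
    {T : Matrix (Fin a) (Fin n) ℝ} (hT : T * A = Au * T) (L : σ → Fin n → ℝ) (C : Fin n → ℝ)
    {M : Matrix (Fin n) (Fin n) ℝ} (hM : M.PosSemidef) :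
    (∑ s, w s * (1 - t s)) * Au.det ^ 2 * (T * M * Tᵀ).det
      ≤ (T * kraus w (fun s => A + t s • vecMulVec (L s) C) M * Tᵀ).det := by
  set K := kraus w (fun s => A + t s • vecMulVec (L s) C) M with hK
  have hKp : K.PosSemidef := posSemidef_kraus hw _ hM
  set G := T * M * Tᵀ with hG
  have hGp : G.PosSemidef := posSemidef_conj' hM T
  have hUp : (T * K * Tᵀ).PosSemidef := posSemidef_conj' hKp T
  rcases eq_or_ne G.det 0 with h0 | h0
  · rw [h0, mul_zero]; exact hUp.det_nonneg
  have hGd := posDef_of_posSemidef_of_det_ne_zero hGp h0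
  have hMs := symm_of_posSemidef hM
  set h : Fin a → ℝ := T *ᵥ (M *ᵥ C) with hh
  set κ := h ⬝ᵥ G⁻¹ *ᵥ h with hκ
  set α := ∑ s, w s * (1 - t s) with hα
  have ht01 : ∀ s, 0 ≤ t s ∧ t s ≤ 1 := fun s => by rcases ht s with h | h <;> simp [h]
  have hα0 : 0 ≤ α := Finset.sum_nonneg fun s _ => mul_nonneg (hw s) (sub_nonneg.2 (ht01 s).2)
  have hα1 : 1 - α = ∑ s, w s * t s := by
    have : α + ∑ s, w s * t s = ∑ s, w s := by
      rw [hα, ← Finset.sum_add_distrib]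
      exact Finset.sum_congr rfl fun s _ => by ring
    linarith
  have hα1' : 0 ≤ 1 - α := hα1 ▸ Finset.sum_nonneg fun s _ => mul_nonneg (hw s) (ht01 s).1
  have hκ0 : 0 ≤ κ := quad_nonneg hGd.inv.posSemidef h
  have hGG : ∀ x, G *ᵥ (G⁻¹ *ᵥ x) = x := fun x => by
    rw [mulVec_mulVec, mul_nonsing_inv _ h0.isUnit, one_mulVec]
  have hexp : ∀ y τ, quad M (Tᵀ *ᵥ y + τ • C)
      = quad G y + 2 * τ * (h ⬝ᵥ y) + τ ^ 2 * quad M C := fun y τ => by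
    have e1 : (Tᵀ *ᵥ y) ⬝ᵥ M *ᵥ C = h ⬝ᵥ y := by
      rw [mulVec_transpose, ← dotProduct_mulVec, dotProduct_comm]
    rw [quad_add_vec hMs, quad_mulVec, transpose_transpose, quad_smul_vec, mulVec_smul,
      dotProduct_smul, e1, smul_eq_mul]
    ring
  -- `κ` is the part of `Cᵀ M C` explained by the compressed coordinates; nonnegativity of the Schur
  -- complement gives the bound.
  have hκC : κ ≤ quad M C := by
    have h1 := quad_nonneg hM (Tᵀ *ᵥ (G⁻¹ *ᵥ h) + (-1 : ℝ) • C)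
    have h2 : quad G (G⁻¹ *ᵥ h) = κ := by rw [quad, hGG, dotProduct_comm]
    rw [hexp, h2, ← hκ] at h1
    linarith
  have hκz : κ = 0 → h = 0 := fun hz => by
    by_contra hne
    exact (quad_pos hGd.inv hne).ne' hz
  have hcs : ∀ y, κ⁻¹ * (h ⬝ᵥ y) ^ 2 ≤ quad G y := fun y => by
    rcases eq_or_ne κ 0 with hz | hz
    · rw [hz, _root_.inv_zero, zero_mul]; exact quad_nonneg hGp y
    have h1 := quad_nonneg hGp (y + (-(κ⁻¹ * (h ⬝ᵥ y))) • (G⁻¹ *ᵥ h))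
    have h2 : quad G (G⁻¹ *ᵥ h) = κ := by rw [quad, hGG, dotProduct_comm]
    rw [quad_add_vec (symm_of_posSemidef hGp), quad_smul_vec, mulVec_smul, hGG, h2,
      dotProduct_smul, smul_eq_mul, dotProduct_comm y h] at h1
    have h3 : (-(κ⁻¹ * (h ⬝ᵥ y))) ^ 2 * κ = κ⁻¹ * (h ⬝ᵥ y) ^ 2 := by
      field_simp
    rw [h3] at h1
    linarith
  -- Whatever the gain, an arriving measurement leaves at least this form. For positive `quad M C`
  -- the exact minimum over `τ` has `quad M C` in place of `κ`; the smaller `κ` makes the rank-one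
  -- determinant below equal to a clean multiple of `det G`.
  have hlow : ∀ y τ, quad G y - κ⁻¹ * (h ⬝ᵥ y) ^ 2 ≤ quad M (Tᵀ *ᵥ y + τ • C) := fun y τ => by
    rw [hexp]
    have h1 := mul_le_mul_of_nonneg_left hκC (sq_nonneg τ)
    rcases eq_or_ne κ 0 with hz | hz
    · have h2 : h ⬝ᵥ y = 0 := by rw [hκz hz, zero_dotProduct]
      rw [h2]
      have h3 := mul_nonneg (sq_nonneg τ) (quad_nonneg hM C)
      linarith
    · have hpos : 0 < κ := lt_of_le_of_ne hκ0 hz.symm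
      have h2 : 0 ≤ κ⁻¹ * (h ⬝ᵥ y + τ * κ) ^ 2 := by positivity
      have h3 : κ⁻¹ * (h ⬝ᵥ y + τ * κ) ^ 2
          = κ⁻¹ * (h ⬝ᵥ y) ^ 2 + 2 * τ * (h ⬝ᵥ y) + τ ^ 2 * κ := by
        field_simp
        ring
      linarith
  -- The average of `G` with weight `α` and `G - κ⁻¹ h hᵀ` with weight `1 - α`. For `κ ≠ 0` its
  -- determinant is `α det G`; for `κ = 0` also `h = 0` and `Z = G`.
  set Z := G + vecMulVec (-((1 - α) * κ⁻¹) • h) h with hZ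
  have hZq : ∀ y, quad Z y = quad G y - (1 - α) * (κ⁻¹ * (h ⬝ᵥ y) ^ 2) := fun y => by
    rw [hZ, quad_add, smul_vecMulVec, quad_smul, quad_vecMulVec]; ring
  have hZs : Zᵀ = Z := by
    rw [hZ, transpose_add, symm_of_posSemidef hGp, smul_vecMulVec, transpose_smul,
      transpose_vecMulVec]
  have hZp : Z.PosSemidef := posSemidef_of_quad hZs fun y => by
    rw [hZq]
    have h1 := hcs y
    have h2 : 0 ≤ κ⁻¹ * (h ⬝ᵥ y) ^ 2 := by positivity
    have h3 : (1 - α) * (κ⁻¹ * (h ⬝ᵥ y) ^ 2) ≤ 1 * (κ⁻¹ * (h ⬝ᵥ y) ^ 2) :=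
      mul_le_mul_of_nonneg_right (by linarith) h2
    linarith
  have hcmp : ∀ x, quad (Au * Z * Auᵀ) x ≤ quad (T * K * Tᵀ) x := fun x => by
    have e1 : quad (Au * Z * Auᵀ) x = quad Z (Auᵀ *ᵥ x) := by rw [quad_mulVec, transpose_transpose]
    have e2 : quad (T * K * Tᵀ) x = quad K (Tᵀ *ᵥ x) := by rw [quad_mulVec, transpose_transpose]
    rw [e1, e2, hK, quad_kraus, hZq]
    set y := Auᵀ *ᵥ x with hy
    have e3 : Aᵀ *ᵥ (Tᵀ *ᵥ x) = Tᵀ *ᵥ y := by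
      rw [hy, mulVec_mulVec, mulVec_mulVec, ← transpose_mul, ← transpose_mul, hT]
    have e4 : ∀ s, (A + t s • vecMulVec (L s) C)ᵀ *ᵥ (Tᵀ *ᵥ x)
        = Tᵀ *ᵥ y + (t s * (L s ⬝ᵥ (Tᵀ *ᵥ x))) • C := fun s => by
      rw [transpose_add, add_mulVec, e3, transpose_smul, transpose_vecMulVec, smul_mulVec,
        vecMulVec_mulVec, op_smul_eq_smul, smul_smul]
    simp only [e4]
    have h1 : ∀ s, w s * (quad G y - t s * (κ⁻¹ * (h ⬝ᵥ y) ^ 2))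
        ≤ w s * quad M (Tᵀ *ᵥ y + (t s * (L s ⬝ᵥ (Tᵀ *ᵥ x))) • C) := fun s => by
      refine mul_le_mul_of_nonneg_left ?_ (hw s)
      rcases ht s with h0 | h1
      · rw [h0, zero_mul, zero_mul, zero_smul, add_zero, sub_zero, quad_mulVec M,
          transpose_transpose]
      · rw [h1, one_mul, one_mul]
        exact hlow _ _
    refine le_trans (le_of_eq ?_) (Finset.sum_le_sum fun s _ => h1 s)
    rw [hα1, Finset.sum_mul]
    conv_lhs => rw [← one_mul (quad G y), ← hw1, Finset.sum_mul, ← Finset.sum_sub_distrib]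
    exact Finset.sum_congr rfl fun s _ => by ring
  have hdet := det_le_det_of_quad_le (posSemidef_conj' hZp Au) (symm_of_posSemidef hUp) hcmp
  refine le_trans ?_ hdet
  have hZdet : α * G.det ≤ Z.det := by
    rw [hZ, det_add_vecMulVec h0.isUnit, mulVec_smul, dotProduct_smul, ← hκ, smul_eq_mul]
    rcases eq_or_ne κ 0 with hz | hz
    · rw [hz, mul_zero, add_zero, mul_one]
      exact mul_le_of_le_one_left hGd.det_pos.le (by linarith)
    · have : 1 + -((1 - α) * κ⁻¹) * κ = α := by field_simp; ring
      rw [this, mul_comm]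
  rw [det_mul, det_mul, det_transpose]
  nlinarith [mul_le_mul_of_nonneg_left hZdet (sq_nonneg Au.det)]

/-- Lower bound for a product of per-step factors over whole sampling periods. -/
theorem prod_pulse_factor {d : ℕ} (hd : d ≠ 0) (α D : ℝ) (l : ℕ) :
    ∏ i ∈ Finset.range (d * l), ((1 - pulse d i * (1 - α)) * D) = (α * D ^ d) ^ l := by
  induction l with
  | zero => simp
  | succ l ih =>
    rw [mul_add, mul_one, Finset.prod_range_add, ih, pow_succ]
    congr 1
    obtain ⟨e, rfl⟩ := Nat.exists_eq_succ_of_ne_zero hd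
    rw [Nat.succ_eq_add_one, Finset.prod_range_succ']
    have h1 : ∀ i ∈ Finset.range e,
        (1 - pulse (e + 1) ((e + 1) * l + (i + 1)) * (1 - α)) * D = D := fun i hi => by
      have : ¬ (e + 1) ∣ (e + 1) * l + (i + 1) := fun h => by
        rw [Nat.dvd_add_right (dvd_mul_right _ _)] at h
        exact absurd (Nat.le_of_dvd (Nat.succ_pos i) h)
          (by have := Finset.mem_range.1 hi; omega)
      rw [pulse, if_neg this]; ring
    rw [Finset.prod_congr rfl h1, Finset.prod_const, Finset.card_range, pulse,
      if_pos (by simp), pow_succ]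
    ring

/-- A positive semidefinite sequence that tends to zero cannot obey a nonvanishing determinant
bound on a compression. -/
theorem lt_one_of_trace_tendsto_zero (ha : 0 < a) {T : Matrix (Fin a) (Fin n) ℝ}
    (hT : 0 < (T * Tᵀ).det) {X : ℕ → Matrix (Fin n) (Fin n) ℝ} (hX : ∀ k, (X k).PosSemidef)
    (hlim : Filter.Tendsto (fun k => (X k).trace) Filter.atTop (nhds 0)) {β : ℝ} {d : ℕ}
    (hd : d ≠ 0) (hdet : ∀ l, β ^ l * (T * Tᵀ).det ≤ (T * X (d * l) * Tᵀ).det) : β < 1 := by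
  by_contra! hβ
  have hXlim : Filter.Tendsto X Filter.atTop (nhds 0) := by
    refine tendsto_pi_nhds.2 fun i => tendsto_pi_nhds.2 fun j => ?_
    exact squeeze_zero_norm (fun k => abs_entry_le_trace (hX k) i j) hlim
  have hsub : Filter.Tendsto (fun l : ℕ => d * l) Filter.atTop Filter.atTop :=
    Filter.tendsto_id.const_mul_atTop' (Nat.pos_of_ne_zero hd)
  have hcont : Continuous fun M : Matrix (Fin n) (Fin n) ℝ => (T * M * Tᵀ).det := by fun_prop
  have h1 := (hcont.tendsto 0).comp (hXlim.comp hsub)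
  have : Nonempty (Fin a) := ⟨⟨0, ha⟩⟩
  simp only [Matrix.mul_zero, Matrix.zero_mul, det_zero] at h1
  -- If `β ≥ 1`, the determinants stay above `det (T Tᵀ) > 0`, yet they tend to `det 0`, which
  -- vanishes because `0 < a`.
  have h2 : (T * Tᵀ).det ≤ 0 := ge_of_tendsto h1 (Filter.Eventually.of_forall fun l =>
    (le_mul_of_one_le_left hT.le (one_le_pow₀ hβ)).trans (hdet l))
  exact absurd hT (not_lt.2 h2)

variable {w : σ → ℝ} (hw : ∀ s, 0 ≤ w s) (hw1 : ∑ s, w s = 1) {t : σ → ℝ}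
  (ht : ∀ s, t s = 0 ∨ t s = 1) {α : ℝ} (hα : ∑ s, w s * (1 - t s) = α)
  {A : Matrix (Fin n) (Fin n) ℝ} (hA : Unstable A) {d : ℕ} (hd : d ≠ 0)

theorem eigenvalues_transpose (A : Matrix (Fin n) (Fin n) ℝ) :
    eigenvalues Aᵀ = eigenvalues A := by
  rw [eigenvalues, transpose_map, charpoly_transpose, eigenvalues]

theorem unstableProd_transpose (A : Matrix (Fin n) (Fin n) ℝ) (k : ℕ) :
    unstableProd Aᵀ k = unstableProd A k := by
  rw [unstableProd, eigenvalues_transpose, unstableProd]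

include hA in
/-- The left-invariant unstable part of an unstable matrix. -/
theorem exists_unstable_compression :
    ∃ (a : ℕ) (Au : Matrix (Fin a) (Fin a) ℝ) (T : Matrix (Fin a) (Fin n) ℝ), 0 < a ∧
      T * A = Au * T ∧ 0 < (T * Tᵀ).det ∧ ∀ k, unstableProd A k = |Au.det| ^ k := by
  classical
  obtain ⟨a, b, Au, As, T, S, hST, hTS, hTA, hu, hs⟩ :=
    exists_spectral_splitting A (fun z => 1 < ‖z‖) (by simp)
  set Tu := T.submatrix Sum.inl id with hTu
  set Su := S.submatrix id Sum.inl with hSu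
  have hTSu : Tu * Su = 1 := by
    ext i j
    have := congrFun (congrFun hTS (Sum.inl i)) (Sum.inl j)
    simpa [Matrix.mul_apply, Matrix.one_apply, hTu, hSu] using this
  refine ⟨a, Au, Tu, ?_, ?_, ?_, unstableProd_eq_abs_det_pow hu⟩
  · obtain ⟨z, hz, hz1⟩ := hA
    by_contra h0
    obtain rfl : a = 0 := by omega
    have h1 : z ∈ eigenvalues Au := by rw [hu]; exact Multiset.mem_filter.2 ⟨hz, hz1⟩
    simp [eigenvalues, charpoly] at h1
  · ext i j
    have := congrFun (congrFun hTA (Sum.inl i)) j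
    simpa [Matrix.mul_apply, hTu] using this
  · have h1 : (Tuᵀᵀ * (1 : Matrix (Fin n) (Fin n) ℝ) * Tuᵀ).PosDef := posDef_conj PosDef.one fun x hx => by
      have h2 : Suᵀ * Tuᵀ = 1 := by rw [← transpose_mul, hTSu, transpose_one]
      rw [← one_mulVec x, ← h2, ← mulVec_mulVec, hx, mulVec_zero]
    simpa using h1.det_pos

-- Off the sampling instants every message counts as lost, so `1 - pulse d k * (1 - α)` is the
-- effective loss probability at time `k`.
include hw hw1 ht hα in
theorem det_kraus_pulse_ge {a : ℕ} {Au : Matrix (Fin a) (Fin a) ℝ} {T : Matrix (Fin a) (Fin n) ℝ}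
    (hT : T * A = Au * T) (L : σ → Fin n → ℝ) (C : Fin n → ℝ) (k : ℕ)
    {M : Matrix (Fin n) (Fin n) ℝ} (hM : M.PosSemidef) :
    (1 - pulse d k * (1 - α)) * |Au.det| ^ 2 * (T * M * Tᵀ).det
      ≤ (T * kraus w (fun s => A + (pulse d k * t s) • vecMulVec (L s) C) M * Tᵀ).det := by
  have h1 := det_kraus_ge hw hw1 (t := fun s => pulse d k * t s) (fun s => by
    rcases pulse_eq_zero_or_one d k with h | h <;> rcases ht s with h' | h' <;> simp [h, h'])
    hT L C hM
  have h2 : ∑ s, w s * (1 - pulse d k * t s) = 1 - pulse d k * (1 - α) := by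
    have h3 : ∑ s, w s * (1 - pulse d k * t s)
        = (1 - pulse d k) * ∑ s, w s + pulse d k * ∑ s, w s * (1 - t s) := by
      rw [Finset.mul_sum, Finset.mul_sum, ← Finset.sum_add_distrib]
      exact Finset.sum_congr rfl fun s _ => by ring
    rw [h3, hw1, hα]
    ring
  rw [h2] at h1
  rwa [sq_abs]

include hw ht hα in
theorem pulse_factor_nonneg (D : ℝ) (k : ℕ) :
    0 ≤ (1 - pulse d k * (1 - α)) * |D| ^ 2 := by
  have h1 : 0 ≤ α := hα ▸ Finset.sum_nonneg fun s _ => mul_nonneg (hw s) (by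
    rcases ht s with h | h <;> simp [h])
  refine mul_nonneg ?_ (sq_nonneg _)
  rcases pulse_eq_zero_or_one d k with h | h <;> simp [h, h1]

include hw hw1 ht hα hA hd in
/-- Necessary loss bound for the second moments of the estimation error. -/
theorem loss_bound_of_moment_tendsto (L : ℕ → σ → Fin n → ℝ) (C : Fin n → ℝ)
    (hlim : Filter.Tendsto (fun k => (moment w
      (fun k s => A + (pulse d k * t s) • vecMulVec (L k s) C) 1 k).trace) Filter.atTop (nhds 0)) :
    α * unstableProd A (2 * d) < 1 := by
  obtain ⟨a, Au, T, ha, hT, hTT, hprod⟩ := exists_unstable_compression hA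
  rw [hprod, pow_mul]
  refine lt_one_of_trace_tendsto_zero ha hTT
    (fun k => posSemidef_moment hw _ PosSemidef.one k) hlim hd fun l => ?_
  rw [← prod_pulse_factor hd]
  generalize d * l = K
  induction K with
  | zero => simp [moment]
  | succ K ih =>
    refine le_trans ?_ (det_kraus_pulse_ge hw hw1 ht hα hT (L K) C K
      (posSemidef_moment hw _ PosSemidef.one K))
    rw [Finset.prod_range_succ, mul_comm (∏ _ ∈ _, _), mul_assoc]
    exact mul_le_mul_of_nonneg_left ih (pulse_factor_nonneg hw ht hα _ K)

include hw hw1 ht hα hA hd in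
/-- Necessary loss bound for the second moments of the controlled state. -/
theorem loss_bound_of_moment_tendsto' (F : ℕ → σ → Fin n → ℝ) (B : Fin n → ℝ)
    (hlim : Filter.Tendsto (fun k => (moment w
      (fun k s => A + (pulse d k * t s) • vecMulVec B (F k s)) 1 k).trace) Filter.atTop (nhds 0)) :
    α * unstableProd A (2 * d) < 1 := by
  have hA' : Unstable Aᵀ := by rwa [Unstable, eigenvalues_transpose]
  obtain ⟨a, Au, T, ha, hT, hTT, hprod⟩ := exists_unstable_compression hA'
  rw [← unstableProd_transpose, hprod, pow_mul]
  set Φ : ℕ → σ → Matrix (Fin n) (Fin n) ℝ :=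
    fun k s => A + (pulse d k * t s) • vecMulVec B (F k s) with hΦ
  have htr : ∀ k, (adjMoment w Φ k 1).trace = (moment w Φ 1 k).trace := fun k => by
    simpa using trace_adjMoment_mul w Φ k 1 1
  refine lt_one_of_trace_tendsto_zero ha hTT (X := fun k => adjMoment w Φ k 1)
    (fun k => posSemidef_adjMoment hw _ k PosSemidef.one) (by simpa only [htr] using hlim) hd
    fun l => ?_
  rw [← prod_pulse_factor hd]
  -- `adjMoment` applies the latest mode first, so the induction has to run over all `Q`.
  have key : ∀ K (Q : Matrix (Fin n) (Fin n) ℝ), Q.PosSemidef →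
      (∏ i ∈ Finset.range K, ((1 - pulse d i * (1 - α)) * |Au.det| ^ 2)) * (T * Q * Tᵀ).det
        ≤ (T * adjMoment w Φ K Q * Tᵀ).det := fun K => by
    induction K with
    | zero => intro Q _; simp [adjMoment]
    | succ K ih =>
      intro Q hQ
      refine le_trans ?_ (ih _ (posSemidef_kraus hw _ hQ))
      have h1 := det_kraus_pulse_ge (d := d) hw hw1 ht hα hT (F K) B K hQ
      have h2 : (fun s => (Φ K s)ᵀ) = fun s => Aᵀ + (pulse d K * t s) • vecMulVec (F K s) B := by
        funext s
        rw [hΦ, transpose_add, transpose_smul, transpose_vecMulVec]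
      rw [h2, Finset.prod_range_succ, mul_assoc]
      exact mul_le_mul_of_nonneg_left h1
        (Finset.prod_nonneg fun i _ => pulse_factor_nonneg hw ht hα _ i)
  simpa using key (d * l) 1 PosSemidef.one

end DeterminantBound

/-! ### Expectations along recursions driven by independent modes. -/

section RandomRecursion

variable {Ω : Type*} [MeasurableSpace Ω] {μ : Measure Ω} {σ : Type*} [Fintype σ]
  [MeasurableSpace σ] [MeasurableSingletonClass σ] {θ : ℕ → Ω → σ} {E : Type*}
  {f : ℕ → σ → E → E} {z : ℕ → Ω → E} {z₀ : E}

-- The state is a function of the earlier modes alone. With finitely many modes this gives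
-- measurability without any structure on `E`, and independence from the current mode.
omit [Fintype σ] [MeasurableSpace Ω] [MeasurableSpace σ] [MeasurableSingletonClass σ] in
theorem exists_factor_through_past (h0 : ∀ ω, z 0 ω = z₀)
    (hstep : ∀ k ω, z (k + 1) ω = f k (θ k ω) (z k ω)) (k : ℕ) :
    ∃ G : (Finset.range k → σ) → E, ∀ ω, z k ω = G fun i => θ i ω := by
  induction k with
  | zero => exact ⟨fun _ => z₀, h0⟩
  | succ k ih =>
    obtain ⟨G, hG⟩ := ih
    refine ⟨fun h => f k (h ⟨k, Finset.self_mem_range_succ k⟩)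
      (G fun i => h ⟨i, Finset.mem_range.2 ((Finset.mem_range.1 i.2).trans k.lt_succ_self)⟩),
      fun ω => ?_⟩
    rw [hstep, hG]

theorem measurable_comp_recursion (hm : ∀ k, Measurable (θ k)) (h0 : ∀ ω, z 0 ω = z₀)
    (hstep : ∀ k ω, z (k + 1) ω = f k (θ k ω) (z k ω)) (k : ℕ) (g : E → ℝ≥0∞) :
    Measurable fun ω => g (z k ω) := by
  obtain ⟨G, hG⟩ := exists_factor_through_past h0 hstep k
  simp only [hG]
  exact (measurable_of_finite fun h => g (G h)).comp (measurable_pi_lambda _ fun i => hm i)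

/-- Conditioning on the current mode, which is independent of the past. -/
theorem lintegral_recursion_succ (hm : ∀ k, Measurable (θ k)) (hind : iIndepFun θ μ)
    (h0 : ∀ ω, z 0 ω = z₀) (hstep : ∀ k ω, z (k + 1) ω = f k (θ k ω) (z k ω)) (k : ℕ)
    (g : E → ℝ≥0∞) :
    ∫⁻ ω, g (z (k + 1) ω) ∂μ = ∑ s, μ (θ k ⁻¹' {s}) * ∫⁻ ω, g (f k s (z k ω)) ∂μ := by
  classical
  obtain ⟨G, hG⟩ := exists_factor_through_past h0 hstep k
  have hind2 : IndepFun (θ k) (fun ω (i : Finset.range k) => θ i ω) μ := by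
    have h1 := hind.indepFun_finset {k} (Finset.range k) (by simp) hm
    exact h1.comp (φ := fun h : ({k} : Finset ℕ) → σ => h ⟨k, Finset.mem_singleton_self k⟩)
      (ψ := id) (measurable_pi_apply _) measurable_id
  have hsplit : ∀ ω, g (z (k + 1) ω)
      = ∑ s, (if θ k ω = s then (1 : ℝ≥0∞) else 0) * g (f k s (z k ω)) := fun ω => by
    rw [hstep]
    simp
  have hmeas : ∀ s, Measurable fun ω => if θ k ω = s then (1 : ℝ≥0∞) else 0 := fun s =>
    (measurable_of_finite fun r : σ => if r = s then (1 : ℝ≥0∞) else 0).comp (hm k)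
  have hmeas2 : ∀ s, Measurable fun ω => g (f k s (z k ω)) := fun s =>
    measurable_comp_recursion hm h0 hstep k fun e => g (f k s e)
  simp only [hsplit]
  have hprod : ∀ s ∈ Finset.univ,
      Measurable fun ω => (if θ k ω = s then (1 : ℝ≥0∞) else 0) * g (f k s (z k ω)) :=
    fun s _ => (hmeas s).mul (hmeas2 s)
  rw [lintegral_finsetSum _ hprod]
  refine Finset.sum_congr rfl fun s _ => ?_
  have hI : IndepFun (fun ω => if θ k ω = s then (1 : ℝ≥0∞) else 0)
      (fun ω => g (f k s (z k ω))) μ := by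
    have := hind2.comp (φ := fun r : σ => if r = s then (1 : ℝ≥0∞) else 0)
      (ψ := fun h => g (f k s (G h))) (measurable_of_finite _) (measurable_of_finite _)
    simpa only [Function.comp_def, ← hG] using this
  have hmul := lintegral_mul_eq_lintegral_mul_lintegral_of_indepFun (hmeas s) (hmeas2 s) hI
  simp only [Pi.mul_apply] at hmul
  rw [hmul]
  congr 1
  have : (fun ω => if θ k ω = s then (1 : ℝ≥0∞) else 0)
      = (θ k ⁻¹' {s}).indicator fun _ => 1 := by
    funext ω
    simp [Set.indicator_apply]
  rw [this, lintegral_indicator_const (hm k (measurableSet_singleton s)), one_mul]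

variable {w : σ → ℝ} (hw : ∀ s, 0 ≤ w s)
  (hlaw : ∀ k s, μ (θ k ⁻¹' {s}) = ENNReal.ofReal (w s))

include hw hlaw in
theorem lintegral_recursion_succ_ofReal (hm : ∀ k, Measurable (θ k)) (hind : iIndepFun θ μ)
    (h0 : ∀ ω, z 0 ω = z₀) (hstep : ∀ k ω, z (k + 1) ω = f k (θ k ω) (z k ω)) (k : ℕ)
    {g : E → ℝ} (hg : ∀ e, 0 ≤ g e) :
    ∫⁻ ω, ENNReal.ofReal (g (z (k + 1) ω)) ∂μ
      = ∫⁻ ω, ENNReal.ofReal (∑ s, w s * g (f k s (z k ω))) ∂μ := by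
  rw [lintegral_recursion_succ hm hind h0 hstep k fun e => ENNReal.ofReal (g e)]
  have h1 : ∀ ω, ENNReal.ofReal (∑ s, w s * g (f k s (z k ω)))
      = ∑ s, ENNReal.ofReal (w s) * ENNReal.ofReal (g (f k s (z k ω))) := fun ω => by
    rw [ENNReal.ofReal_sum_of_nonneg fun s _ => mul_nonneg (hw s) (hg _)]
    exact Finset.sum_congr rfl fun s _ => ENNReal.ofReal_mul (hw s)
  simp only [h1]
  have hmeas : ∀ s, Measurable fun ω => ENNReal.ofReal (g (f k s (z k ω))) := fun s =>
    measurable_comp_recursion hm h0 hstep k fun e => ENNReal.ofReal (g (f k s e))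
  rw [lintegral_finsetSum _ fun s _ => (hmeas s).const_mul _]
  exact Finset.sum_congr rfl fun s _ => by rw [lintegral_const_mul _ (hmeas s), hlaw]

include hw hlaw in
/-- Quadratic expectations of a random linear recursion. -/
theorem lintegral_quad_eq_trace_moment [IsProbabilityMeasure μ] {ι : Type*} [Fintype ι]
    (hm : ∀ k, Measurable (θ k)) (hind : iIndepFun θ μ) {Φ : ℕ → σ → Matrix ι ι ℝ}
    {x : ℕ → Ω → ι → ℝ} {x₀ : ι → ℝ} (h0 : ∀ ω, x 0 ω = x₀)
    (hstep : ∀ k ω, x (k + 1) ω = Φ k (θ k ω) *ᵥ x k ω) (k : ℕ) {Q : Matrix ι ι ℝ}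
    (hQ : Q.PosSemidef) :
    ∫⁻ ω, ENNReal.ofReal (quad Q (x k ω)) ∂μ
      = ENNReal.ofReal (Q * moment w Φ (vecMulVec x₀ x₀) k).trace := by
  induction k generalizing Q with
  | zero =>
    simp only [h0, lintegral_const, measure_univ, mul_one, moment]
    congr 1
    rw [mul_vecMulVec, trace_vecMulVec, quad, dotProduct_comm]
  | succ k ih =>
    rw [lintegral_recursion_succ_ofReal (f := fun k s e => Φ k s *ᵥ e) hw hlaw hm hind h0 hstep k
      (quad_nonneg hQ)]
    have h1 : ∀ e, ∑ s, w s * quad Q (Φ k s *ᵥ e)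
        = quad (kraus w (fun s => (Φ k s)ᵀ) Q) e := fun e => by
      rw [quad_kraus]
      simp only [transpose_transpose]
    simp only [h1]
    rw [ih (posSemidef_kraus hw _ hQ), trace_kraus_transpose_mul, moment]

end RandomRecursion

/-! ### Switching patterns, mode weights and the closed loop. -/

section Plant

variable {n N : ℕ}

theorem switch_eq_pulse [NeZero N] {s : Fin N → Fin 2} (hs : IsPeriodicVector s) (k : ℕ) :
    switch s k = pulse (N / numOnes s) k := by
  have h1 : ((Fin.ofNat N k : Fin N) : ℕ) = k % N := rfl
  have h2 : N / numOnes s ∣ k % N ↔ N / numOnes s ∣ k :=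
    Nat.dvd_mod_iff (Nat.div_dvd_of_dvd hs.2.1)
  simp only [switch, hs.2.2, h1, pulse, h2]
  split_ifs <;> simp

theorem div_numOnes_ne_zero [NeZero N] {s : Fin N → Fin 2} (hs : IsPeriodicVector s) :
    N / numOnes s ≠ 0 :=
  (Nat.div_pos (Nat.le_of_dvd (Nat.pos_of_ne_zero (NeZero.ne N)) hs.2.1) hs.1).ne'

theorem eq_zero_of_orthogonal_of_span_eq_top {τ : Type*} {f : τ → Fin n → ℝ}
    (hf : Submodule.span ℝ (Set.range f) = ⊤) {v : Fin n → ℝ} (hv : ∀ i, v ⬝ᵥ f i = 0) :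
    v = 0 := by
  have h1 : ∀ x ∈ Submodule.span ℝ (Set.range f), v ⬝ᵥ x = 0 := fun x hx => by
    induction hx using Submodule.span_induction with
    | mem x hx => obtain ⟨i, rfl⟩ := hx; exact hv i
    | zero => simp
    | add x y _ _ hx hy => rw [dotProduct_add, hx, hy, add_zero]
    | smul c x _ hx => rw [dotProduct_smul, hx, smul_zero]
  exact dotProduct_self_eq_zero.1 (h1 v (hf ▸ Submodule.mem_top))

theorem Plant.Controllable.eq_zero {G : Plant n} (h : G.Controllable) (v : Fin n → ℝ)
    (hv : ∀ i : ℕ, v ⬝ᵥ G.A ^ i *ᵥ G.B = 0) : v = 0 :=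
  eq_zero_of_orthogonal_of_span_eq_top h fun i => hv i

theorem Plant.Observable.eq_zero {G : Plant n} (h : G.Observable) (v : Fin n → ℝ)
    (hv : ∀ i : ℕ, v ⬝ᵥ G.Aᵀ ^ i *ᵥ G.C = 0) : v = 0 :=
  eq_zero_of_orthogonal_of_span_eq_top h fun i => by
    have := hv i
    rwa [← transpose_pow, mulVec_transpose] at this

theorem unstableProd_pos (A : Matrix (Fin n) (Fin n) ℝ) (k : ℕ) : 0 < unstableProd A k := by
  classical
  rw [unstableProd, prod_map_pow_norm]
  refine pow_pos (lt_of_le_of_ne (Multiset.prod_nonneg fun x hx => ?_) (Ne.symm ?_)) k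
  · obtain ⟨z, _, rfl⟩ := Multiset.mem_map.1 hx
    exact norm_nonneg z
  · refine Multiset.prod_ne_zero fun h => ?_
    obtain ⟨z, hz, h0⟩ := Multiset.mem_map.1 h
    have := (Multiset.mem_filter.1 hz).2
    rw [h0] at this
    exact absurd this (by norm_num)

variable {Ω : Type*} [MeasurableSpace Ω] {μ : Measure Ω} {θ₁ θ₂ : ℕ → Ω → Fin 2} {α₁ α₂ : ℝ}

/-- The value `0` or `1` of a mode, as a real number. -/
def arrival (t : Fin 2) : ℝ := ((t : ℕ) : ℝ)

theorem arrival_eq_zero_or_one (t : Fin 2) : arrival t = 0 ∨ arrival t = 1 := by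
  fin_cases t <;> simp [arrival]

theorem sum_weights_loss [IsProbabilityMeasure μ] {X : Ω → Fin 2 × Fin 2} (hX : Measurable X)
    (π : Fin 2 × Fin 2 → Fin 2) :
    ∑ s, μ.real (X ⁻¹' {s}) * (1 - arrival (π s)) = μ.real {ω | π (X ω) = 0} := by
  classical
  have h1 := sum_measureReal_preimage_singleton (μ := μ) (Finset.univ.filter fun s => π s = 0)
    (f := X) fun s _ => hX (measurableSet_singleton s)
  have h2 : X ⁻¹' ((Finset.univ.filter fun s => π s = 0 : Finset (Fin 2 × Fin 2)) : Set _)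
      = {ω | π (X ω) = 0} := by
    ext ω; simp
  rw [h2] at h1
  rw [← h1, Finset.sum_filter]
  refine Finset.sum_congr rfl fun s _ => ?_
  generalize π s = t
  fin_cases t <;> simp [arrival]

/-- The mode weights of a loss process. -/
theorem IsLossProcess.exists_weights [IsProbabilityMeasure μ]
    (hθ : IsLossProcess μ θ₁ θ₂ α₁ α₂) :
    ∃ w : Fin 2 × Fin 2 → ℝ, (∀ s, 0 ≤ w s) ∧ ∑ s, w s = 1 ∧
      (∀ k s, μ ((fun ω => (θ₁ k ω, θ₂ k ω)) ⁻¹' {s}) = ENNReal.ofReal (w s)) ∧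
      ∑ s, w s * (1 - arrival s.1) = α₁ ∧ ∑ s, w s * (1 - arrival s.2) = α₂ := by
  have hm : ∀ k, Measurable fun ω => (θ₁ k ω, θ₂ k ω) := fun k =>
    (hθ.measurable_fst k).prodMk (hθ.measurable_snd k)
  refine ⟨fun s => μ.real ((fun ω => (θ₁ 0 ω, θ₂ 0 ω)) ⁻¹' {s}), fun s => measureReal_nonneg, ?_,
    fun k s => ?_, ?_, ?_⟩
  · rw [sum_measureReal_preimage_singleton _ fun s _ => hm 0 (measurableSet_singleton s)]
    simp
  · rw [(hθ.identDistrib k).measure_mem_eq (measurableSet_singleton s), ofReal_measureReal]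
  · rw [sum_weights_loss (hm 0) Prod.fst]; exact hθ.prob_fst 0
  · rw [sum_weights_loss (hm 0) Prod.snd]; exact hθ.prob_snd 0

/-- Only the marginal law of `t` matters, so any correlation between the channels drops out. -/
theorem sum_two_mode {σ : Type*} [Fintype σ] {w : σ → ℝ} (hw1 : ∑ s, w s = 1) {t : σ → ℝ}
    (ht : ∀ s, t s = 0 ∨ t s = 1) {α : ℝ} (hα : ∑ s, w s * (1 - t s) = α) (g : ℝ → ℝ) :
    ∑ s, w s * g (t s) = α * g 0 + (1 - α) * g 1 := by
  have h1 : ∀ s, w s * g (t s) = w s * (1 - t s) * g 0 + (w s - w s * (1 - t s)) * g 1 :=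
    fun s => by rcases ht s with h | h <;> rw [h] <;> ring
  simp only [h1, Finset.sum_add_distrib, ← Finset.sum_mul, Finset.sum_sub_distrib, hα, hw1]

/-! ### Closed-loop recursions and necessity. -/

section ClosedLoop

variable [NeZero N] (G : Plant n) (s₁ s₂ : Fin N → Fin 2) (K : Controller n N)

/-- The applied input enters plant and observer alike and cancels, so neither the feedback gain nor
the actuator switch appears; the actuator loss survives only through the choice of `L`. -/
theorem closedLoop_error_step {d : ℕ} (hs : ∀ k, switch s₁ k = pulse d k) (t₁ t₂ : ℕ → Fin 2)
    (x₀ ξ₀ : Fin n → ℝ) (k : ℕ) :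
    (closedLoop G s₁ s₂ K t₁ t₂ x₀ ξ₀ (k + 1)).2 - (closedLoop G s₁ s₂ K t₁ t₂ x₀ ξ₀ (k + 1)).1
      = (G.A + (pulse d k * arrival (t₁ k)) • vecMulVec (K.L k (t₂ k)) G.C) *ᵥ
        ((closedLoop G s₁ s₂ K t₁ t₂ x₀ ξ₀ k).2 - (closedLoop G s₁ s₂ K t₁ t₂ x₀ ξ₀ k).1) := by
  simp only [closedLoop, step, hs]
  set x := (closedLoop G s₁ s₂ K t₁ t₂ x₀ ξ₀ k).1
  set ξ := (closedLoop G s₁ s₂ K t₁ t₂ x₀ ξ₀ k).2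
  rw [add_mulVec, smul_mulVec, vecMulVec_mulVec, op_smul_eq_smul, smul_smul, mulVec_sub,
    dotProduct_sub]
  have h : ((t₁ k : ℕ) : ℝ) * pulse d k * G.C ⬝ᵥ ξ - ((t₁ k : ℕ) : ℝ) * pulse d k * G.C ⬝ᵥ x
      = pulse d k * arrival (t₁ k) * (G.C ⬝ᵥ ξ - G.C ⬝ᵥ x) := by
    rw [arrival]; ring
  rw [h]
  abel

/-- Cascade form: the autonomous error enters as a disturbance of a state-feedback recursion. -/
theorem closedLoop_observer_step {d₁ d₂ : ℕ} (hs₁ : ∀ k, switch s₁ k = pulse d₁ k)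
    (hs₂ : ∀ k, switch s₂ k = pulse d₂ k) (k : ℕ) (s : Fin 2 × Fin 2)
    (x ξ : Fin n → ℝ) :
    (step G s₁ s₂ K k s.1 s.2 x ξ).2
      = ((pulse d₁ k * arrival s.1) • vecMulVec (K.L k s.2) G.C) *ᵥ (ξ - x)
        + (G.A + (pulse d₂ k * arrival s.2) • vecMulVec G.B (K.F k s.1)) *ᵥ ξ := by
  simp only [step, hs₁, hs₂, add_mulVec, smul_mulVec, vecMulVec_mulVec, op_smul_eq_smul, smul_smul,
    dotProduct_sub]
  have h : ((s.1 : ℕ) : ℝ) * pulse d₁ k * G.C ⬝ᵥ ξ - ((s.1 : ℕ) : ℝ) * pulse d₁ k * G.C ⬝ᵥ x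
      = pulse d₁ k * arrival s.1 * (G.C ⬝ᵥ ξ - G.C ⬝ᵥ x) := by
    rw [arrival]; ring
  have h' : ((s.2 : ℕ) : ℝ) * pulse d₂ k * K.F k s.1 ⬝ᵥ ξ
      = pulse d₂ k * arrival s.2 * K.F k s.1 ⬝ᵥ ξ := by
    rw [arrival]; ring
  rw [h, h']
  abel

/-- With a correct initial estimate the innovation vanishes; this isolates the control problem with
full state information. -/
theorem closedLoop_fst_eq_snd (t₁ t₂ : ℕ → Fin 2) (v : Fin n → ℝ) (k : ℕ) :
    (closedLoop G s₁ s₂ K t₁ t₂ v v k).2 = (closedLoop G s₁ s₂ K t₁ t₂ v v k).1 := by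
  induction k with
  | zero => rfl
  | succ k ih => simp only [closedLoop, step, ih, sub_self, zero_smul, add_zero]

theorem closedLoop_state_step {d : ℕ} (hs : ∀ k, switch s₂ k = pulse d k) (t₁ t₂ : ℕ → Fin 2)
    (v : Fin n → ℝ) (k : ℕ) :
    (closedLoop G s₁ s₂ K t₁ t₂ v v (k + 1)).1
      = (G.A + (pulse d k * arrival (t₂ k)) • vecMulVec G.B (K.F k (t₁ k))) *ᵥ
        (closedLoop G s₁ s₂ K t₁ t₂ v v k).1 := by
  simp only [closedLoop, step, hs, closedLoop_fst_eq_snd, add_mulVec, smul_mulVec,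
    vecMulVec_mulVec, op_smul_eq_smul, smul_smul, arrival]
  rw [mul_comm (pulse d k)]

variable {G s₁ s₂ K}

theorem IsLossProcess.measurable (hθ : IsLossProcess μ θ₁ θ₂ α₁ α₂) (k : ℕ) :
    Measurable fun ω => (θ₁ k ω, θ₂ k ω) :=
  (hθ.measurable_fst k).prodMk (hθ.measurable_snd k)

theorem measurable_comp_closedLoop (hθ : IsLossProcess μ θ₁ θ₂ α₁ α₂) (x₀ ξ₀ : Fin n → ℝ) (k : ℕ)
    (g : (Fin n → ℝ) × (Fin n → ℝ) → ℝ≥0∞) :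
    Measurable fun ω => g (closedLoop G s₁ s₂ K (θ₁ · ω) (θ₂ · ω) x₀ ξ₀ k) :=
  measurable_comp_recursion (θ := fun k ω => (θ₁ k ω, θ₂ k ω))
    (z := fun k ω => closedLoop G s₁ s₂ K (θ₁ · ω) (θ₂ · ω) x₀ ξ₀ k) (z₀ := (x₀, ξ₀))
    (f := fun k s p => step G s₁ s₂ K k s.1 s.2 p.1 p.2) hθ.measurable (fun _ => rfl)
    (fun _ _ => rfl) k g

/-- The terms of a convergent series tend to zero; necessity uses stability only in this form. -/
theorem StochasticallyStable.tendsto_zero (hθ : IsLossProcess μ θ₁ θ₂ α₁ α₂)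
    (h : StochasticallyStable μ θ₁ θ₂ G s₁ s₂ K) (x₀ ξ₀ : Fin n → ℝ) :
    Filter.Tendsto (fun k => ∫⁻ ω, ENNReal.ofReal
      (quad 1 (closedLoop G s₁ s₂ K (θ₁ · ω) (θ₂ · ω) x₀ ξ₀ k).1
        + quad 1 (closedLoop G s₁ s₂ K (θ₁ · ω) (θ₂ · ω) x₀ ξ₀ k).2) ∂μ) Filter.atTop (nhds 0) := by
  have h1 := h x₀ ξ₀
  simp only [← quad_one] at h1
  rw [lintegral_tsum fun k => (measurable_comp_closedLoop hθ x₀ ξ₀ k fun p =>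
    ENNReal.ofReal (quad 1 p.1 + quad 1 p.2)).aemeasurable] at h1
  exact ENNReal.tendsto_atTop_zero_of_tsum_ne_top h1.ne

theorem sum_vecMulVec_single :
    ∑ i : Fin n, vecMulVec (Pi.single i 1) (Pi.single i 1) = (1 : Matrix (Fin n) (Fin n) ℝ) := by
  ext i j
  rw [Matrix.sum_apply]
  simp [vecMulVec_apply, Pi.single_apply, Matrix.one_apply]

/-- If the processes started at every vector tend to zero in mean square, so does the second
moment started at the identity. -/
theorem moment_one_tendsto_zero [IsProbabilityMeasure μ] {w : Fin 2 × Fin 2 → ℝ}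
    (hw : ∀ s, 0 ≤ w s) (hθ : IsLossProcess μ θ₁ θ₂ α₁ α₂)
    (hlaw : ∀ k s, μ ((fun ω => (θ₁ k ω, θ₂ k ω)) ⁻¹' {s}) = ENNReal.ofReal (w s))
    {Φ : ℕ → Fin 2 × Fin 2 → Matrix (Fin n) (Fin n) ℝ} {x : (Fin n → ℝ) → ℕ → Ω → Fin n → ℝ}
    (h0 : ∀ v ω, x v 0 ω = v)
    (hstep : ∀ v k ω, x v (k + 1) ω = Φ k (θ₁ k ω, θ₂ k ω) *ᵥ x v k ω)
    (hlim : ∀ v, Filter.Tendsto (fun k => ∫⁻ ω, ENNReal.ofReal (quad 1 (x v k ω)) ∂μ)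
      Filter.atTop (nhds 0)) :
    Filter.Tendsto (fun k => (moment w Φ 1 k).trace) Filter.atTop (nhds 0) := by
  have h1 : ∀ v : Fin n → ℝ, Filter.Tendsto (fun k => (moment w Φ (vecMulVec v v) k).trace)
      Filter.atTop (nhds 0) := fun v => by
    have hp : (vecMulVec v v : Matrix (Fin n) (Fin n) ℝ).PosSemidef := by
      simpa using posSemidef_vecMulVec_self_star v
    have h2 := (ENNReal.tendsto_toReal ENNReal.zero_ne_top).comp (hlim v)
    refine h2.congr fun k => ?_
    simp only [Function.comp]
    rw [lintegral_quad_eq_trace_moment (θ := fun k ω => (θ₁ k ω, θ₂ k ω)) hw hlaw hθ.measurable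
      hθ.indep (h0 v) (hstep v) k PosSemidef.one, Matrix.one_mul,
      ENNReal.toReal_ofReal (posSemidef_moment hw Φ hp k).trace_nonneg]
  have h3 : ∀ k, (moment w Φ 1 k).trace
      = ∑ i : Fin n, (moment w Φ (vecMulVec (Pi.single i 1) (Pi.single i 1)) k).trace := fun k => by
    rw [← sum_vecMulVec_single, moment_sum, trace_sum]
  simp only [h3]
  simpa using tendsto_finsetSum Finset.univ fun i _ => h1 (Pi.single i 1)

/-- Stochastic stability forces both loss bounds. -/
theorem StochasticallyStable.loss_bounds [IsProbabilityMeasure μ]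
    (hA : Unstable G.A) (hθ : IsLossProcess μ θ₁ θ₂ α₁ α₂) {d₁ d₂ : ℕ} (hd₁ : d₁ ≠ 0)
    (hd₂ : d₂ ≠ 0) (hs₁ : ∀ k, switch s₁ k = pulse d₁ k) (hs₂ : ∀ k, switch s₂ k = pulse d₂ k)
    (h : StochasticallyStable μ θ₁ θ₂ G s₁ s₂ K) :
    α₁ * unstableProd G.A (2 * d₁) < 1 ∧ α₂ * unstableProd G.A (2 * d₂) < 1 := by
  obtain ⟨w, hw, hw1, hlaw, hα₁, hα₂⟩ := hθ.exists_weights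
  constructor
  · refine loss_bound_of_moment_tendsto hw hw1 (fun s => arrival_eq_zero_or_one s.1) hα₁ hA hd₁
      (fun k s => K.L k s.2) G.C ?_
    -- Starting from `x₀ = 0` and `ξ₀ = v`, the error has the arbitrary initial value `v`.
    refine moment_one_tendsto_zero (x := fun v k ω =>
      (closedLoop G s₁ s₂ K (θ₁ · ω) (θ₂ · ω) 0 v k).2
        - (closedLoop G s₁ s₂ K (θ₁ · ω) (θ₂ · ω) 0 v k).1) hw hθ hlaw (fun v ω => ?_)
      (fun v k ω => closedLoop_error_step G s₁ s₂ K hs₁ _ _ 0 v k) fun v => ?_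
    · simp [closedLoop]
    · have h2 := ENNReal.Tendsto.const_mul (a := 2) (h.tendsto_zero hθ 0 v)
        (Or.inr ENNReal.ofNat_ne_top)
      rw [mul_zero] at h2
      refine tendsto_of_tendsto_of_tendsto_of_le_of_le tendsto_const_nhds h2 (fun _ => zero_le)
        fun k => ?_
      rw [← lintegral_const_mul _ (measurable_comp_closedLoop hθ 0 v k fun p =>
        ENNReal.ofReal (quad 1 p.1 + quad 1 p.2))]
      refine lintegral_mono fun ω => ?_
      rw [show (2 : ℝ≥0∞) = ENNReal.ofReal 2 by simp, ← ENNReal.ofReal_mul (by norm_num)]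
      refine ENNReal.ofReal_le_ofReal ?_
      set x := (closedLoop G s₁ s₂ K (θ₁ · ω) (θ₂ · ω) 0 v k).1
      set ξ := (closedLoop G s₁ s₂ K (θ₁ · ω) (θ₂ · ω) 0 v k).2
      have h3 := quad_add_le (PosSemidef.one (n := Fin n) (R := ℝ)) one_pos ξ ((-1 : ℝ) • x)
      rw [quad_smul_vec, neg_one_smul, ← sub_eq_add_neg] at h3
      linarith
  · refine loss_bound_of_moment_tendsto' hw hw1 (fun s => arrival_eq_zero_or_one s.2) hα₂ hA hd₂
      (fun k s => K.F k s.1) G.B ?_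
    refine moment_one_tendsto_zero (x := fun v k ω =>
      (closedLoop G s₁ s₂ K (θ₁ · ω) (θ₂ · ω) v v k).1) hw hθ hlaw (fun v ω => rfl)
      (fun v k ω => closedLoop_state_step G s₁ s₂ K hs₂ _ _ v k) fun v => ?_
    refine tendsto_of_tendsto_of_tendsto_of_le_of_le tendsto_const_nhds (h.tendsto_zero hθ v v)
      (fun _ => zero_le) fun k => lintegral_mono fun ω => ENNReal.ofReal_le_ofReal ?_
    exact le_add_of_nonneg_right (quad_nonneg PosSemidef.one _)

end ClosedLoop

end Plant

/-! ### Construction of a stabilizing controller. -/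

section Sufficiency

variable {n N : ℕ}

/-- A dual certificate bounds the second moments geometrically. -/
theorem quad_moment_le {σ : Type*} [Fintype σ] {w : σ → ℝ} (hw : ∀ s, 0 ≤ w s)
    {Φ : ℕ → σ → Matrix (Fin n) (Fin n) ℝ} {M : ℕ → Matrix (Fin n) (Fin n) ℝ} {ρ c : ℝ}
    (hρ : 0 ≤ ρ) (hc : 0 ≤ c) {M₀ : Matrix (Fin n) (Fin n) ℝ}
    (h0 : ∀ v, quad M₀ v ≤ c * quad (M 0) v)
    (h : ∀ k v, ∑ s, w s * quad (M k) ((Φ k s)ᵀ *ᵥ v) ≤ ρ * quad (M (k + 1)) v) (k : ℕ)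
    (v : Fin n → ℝ) : quad (moment w Φ M₀ k) v ≤ c * ρ ^ k * quad (M k) v := by
  induction k generalizing v with
  | zero => simpa [moment] using h0 v
  | succ k ih =>
    rw [moment, quad_kraus]
    calc ∑ s, w s * quad (moment w Φ M₀ k) ((Φ k s)ᵀ *ᵥ v)
        ≤ ∑ s, c * ρ ^ k * (w s * quad (M k) ((Φ k s)ᵀ *ᵥ v)) :=
          Finset.sum_le_sum fun s _ => by
            have := mul_le_mul_of_nonneg_left (ih ((Φ k s)ᵀ *ᵥ v)) (hw s)
            linarith
      _ = c * ρ ^ k * ∑ s, w s * quad (M k) ((Φ k s)ᵀ *ᵥ v) := (Finset.mul_sum _ _ _).symm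
      _ ≤ c * ρ ^ k * (ρ * quad (M (k + 1)) v) :=
          mul_le_mul_of_nonneg_left (h k v) (mul_nonneg hc (pow_nonneg hρ k))
      _ = c * ρ ^ (k + 1) * quad (M (k + 1)) v := by ring

/-- A scalar recursion driven by a geometric sequence decays geometrically. -/
theorem exists_geometric_bound {a v : ℕ → ℝ≥0∞} {C ρ ρ' c v₀ : ℝ} (hC : 0 ≤ C) (hρ' : 0 ≤ ρ')
    (hρ'1 : ρ' < 1) (hρ : 0 ≤ ρ) (hρ1 : ρ < 1) (hc : 0 ≤ c) (hv₀ : v 0 ≤ ENNReal.ofReal v₀)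
    (ha : ∀ k, a k ≤ ENNReal.ofReal (c * ρ ^ k))
    (hv : ∀ k, v (k + 1) ≤ ENNReal.ofReal C * a k + ENNReal.ofReal ρ' * v k) :
    ∃ D r : ℝ, 0 ≤ D ∧ 0 ≤ r ∧ r < 1 ∧ (∀ k, a k ≤ ENNReal.ofReal (D * r ^ k)) ∧
      ∀ k, v k ≤ ENNReal.ofReal (D * r ^ k) := by
  obtain ⟨r, hr, hr1⟩ := exists_between (max_lt hρ1 hρ'1)
  have hρr : ρ < r := (le_max_left _ _).trans_lt hr
  have hρ'r : ρ' < r := (le_max_right _ _).trans_lt hr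
  have hr0 : 0 ≤ r := hρ.trans hρr.le
  -- The last entry is what the induction step needs: `C c + ρ' D ≤ r D`.
  set D := max (max v₀ c) (C * c / (r - ρ')) with hD
  have hDv : v₀ ≤ D := (le_max_left _ _).trans (le_max_left _ _)
  have hDc : c ≤ D := (le_max_right _ _).trans (le_max_left _ _)
  have hD0 : 0 ≤ D := hc.trans hDc
  have hDC : C * c ≤ D * (r - ρ') := by
    rw [← div_le_iff₀ (sub_pos.2 hρ'r)]; exact le_max_right _ _
  have ha' : ∀ k, a k ≤ ENNReal.ofReal (c * r ^ k) := fun k =>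
    (ha k).trans (ENNReal.ofReal_le_ofReal (by gcongr))
  refine ⟨D, r, hD0, hr0, hr1, fun k => (ha' k).trans (ENNReal.ofReal_le_ofReal (by gcongr)),
    fun k => ?_⟩
  induction k with
  | zero => simpa using hv₀.trans (ENNReal.ofReal_le_ofReal hDv)
  | succ k ih =>
    calc v (k + 1) ≤ ENNReal.ofReal C * a k + ENNReal.ofReal ρ' * v k := hv k
      _ ≤ ENNReal.ofReal C * ENNReal.ofReal (c * r ^ k)
            + ENNReal.ofReal ρ' * ENNReal.ofReal (D * r ^ k) := by
          gcongr
          exact ha' k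
      _ = ENNReal.ofReal (C * (c * r ^ k) + ρ' * (D * r ^ k)) := by
          rw [← ENNReal.ofReal_mul hC, ← ENNReal.ofReal_mul hρ',
            ← ENNReal.ofReal_add (by positivity) (by positivity)]
      _ ≤ ENNReal.ofReal (D * r ^ (k + 1)) := by
          refine ENNReal.ofReal_le_ofReal ?_
          have := mul_le_mul_of_nonneg_right hDC (pow_nonneg hr0 k)
          rw [pow_succ]
          linarith

/-- Reversing the time of a periodic certificate. -/
theorem reversed_certificate_step [NeZero N] {d : ℕ} (hd : d ∣ N)
    {P : ℕ → Matrix (Fin n) (Fin n) ℝ} (hper : ∀ k, P (k + d) = P k) (k : ℕ) :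
    P ((N - 1) * (k + 1) + 1) = P ((N - 1) * k) ∧ pulse d ((N - 1) * k) = pulse d k ∧
      P ((N - 1) * (k + d) + 1) = P ((N - 1) * k + 1) := by
  have hN : N ≠ 0 := NeZero.ne N
  obtain ⟨M, hM⟩ := Nat.exists_eq_succ_of_ne_zero hN
  have hP : Function.Periodic P d := hper
  obtain ⟨e, he⟩ := hd
  refine ⟨?_, ?_, ?_⟩
  -- As `d ∣ N`, the index `(N - 1) * k` stands for `-k` modulo `d`, without subtraction in `ℕ`.
  · have h1 : (N - 1) * (k + 1) + 1 = (N - 1) * k + e * d := by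
      rw [mul_comm e d, ← he, hM, Nat.succ_eq_add_one, Nat.add_sub_cancel]; ring
    rw [h1]
    exact hP.nat_mul e _
  · have h1 : (N - 1) * k + k = d * (e * k) := by
      rw [← mul_assoc, ← he, hM, Nat.succ_eq_add_one, Nat.add_sub_cancel]; ring
    have h2 : d ∣ (N - 1) * k ↔ d ∣ k := by
      have h3 : d ∣ (N - 1) * k + k := h1 ▸ dvd_mul_right _ _
      exact ⟨fun h => (Nat.dvd_add_right h).1 h3, fun h => h.mul_left _⟩
    simp only [pulse, h2]
  · have h1 : (N - 1) * (k + d) + 1 = (N - 1) * k + 1 + (N - 1) * d := by ring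
    rw [h1]
    exact hP.nat_mul (N - 1) _

theorem trace_eq_sum_quad (M : Matrix (Fin n) (Fin n) ℝ) :
    M.trace = ∑ i, quad M (Pi.single i 1) := by
  simp [quad, trace]

variable {Ω : Type*} [MeasurableSpace Ω] {μ : Measure Ω} [IsProbabilityMeasure μ]
  {θ₁ θ₂ : ℕ → Ω → Fin 2} {α₁ α₂ : ℝ}

/-- The loss bounds suffice for a stabilizing controller when the samplings are
nonpathological. -/
theorem exists_stabilizing_controller [NeZero N] {G : Plant n} (hc : G.Controllable)
    (ho : G.Observable) (hθ : IsLossProcess μ θ₁ θ₂ α₁ α₂) {s₁ s₂ : Fin N → Fin 2} {d₁ d₂ : ℕ}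
    (hd₁ : d₁ ∣ N) (hd₂ : d₂ ∣ N) (hs₁ : ∀ k, switch s₁ k = pulse d₁ k)
    (hs₂ : ∀ k, switch s₂ k = pulse d₂ k) (hnp₁ : Nonpathological G.A d₁)
    (hnp₂ : Nonpathological G.A d₂) (hb₁ : α₁ * unstableProd G.A (2 * d₁) < 1)
    (hb₂ : α₂ * unstableProd G.A (2 * d₂) < 1) :
    ∃ K : Controller n N, StochasticallyStable μ θ₁ θ₂ G s₁ s₂ K := by
  have hN : N ≠ 0 := NeZero.ne N
  have hd₁0 : d₁ ≠ 0 := fun h => hN (Nat.eq_zero_of_zero_dvd (h ▸ hd₁))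
  have hd₂0 : d₂ ≠ 0 := fun h => hN (Nat.eq_zero_of_zero_dvd (h ▸ hd₂))
  obtain ⟨w, hw, hw1, hlaw, hα₁, hα₂⟩ := hθ.exists_weights
  have hα₁0 : 0 ≤ α₁ := hθ.prob_fst 0 ▸ measureReal_nonneg
  have hα₁1 : α₁ ≤ 1 := hθ.prob_fst 0 ▸ measureReal_le_one
  have hα₂0 : 0 ≤ α₂ := hθ.prob_snd 0 ▸ measureReal_nonneg
  have hα₂1 : α₂ ≤ 1 := hθ.prob_snd 0 ▸ measureReal_le_one
  obtain ⟨F, P, ρ, hρ0, hρ1, hP, hPper, hF⟩ :=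
    exists_certificate G.A G.B hc.eq_zero hd₂0 hnp₂ hα₂0 hα₂1 hb₂
  -- The observer gain is state feedback for the dual pair `(Aᵀ, C)` over the sensor channel.
  obtain ⟨L, R, η, hη0, hη1, hR, hRper, hL⟩ :=
    exists_certificate G.Aᵀ G.C ho.eq_zero hd₁0
      (by rwa [Nonpathological, eigenvalues_transpose]) hα₁0 hα₁1
      (by rwa [unstableProd_transpose])
  -- Gains independent of time and mode suffice.
  refine ⟨⟨fun _ _ => F, fun _ _ => L, fun _ _ => rfl, fun _ _ => rfl⟩, fun x₀ ξ₀ => ?_⟩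
  set K : Controller n N := ⟨fun _ _ => F, fun _ _ => L, fun _ _ => rfl, fun _ _ => rfl⟩ with hK
  set x : ℕ → Ω → Fin n → ℝ := fun k ω => (closedLoop G s₁ s₂ K (θ₁ · ω) (θ₂ · ω) x₀ ξ₀ k).1
    with hx
  set ξ : ℕ → Ω → Fin n → ℝ := fun k ω => (closedLoop G s₁ s₂ K (θ₁ · ω) (θ₂ · ω) x₀ ξ₀ k).2
    with hξ
  -- the estimation error
  set Φ : ℕ → Fin 2 × Fin 2 → Matrix (Fin n) (Fin n) ℝ :=
    fun k s => G.A + (pulse d₁ k * arrival s.1) • vecMulVec L G.C with hΦ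
  have herr : ∀ k, ∫⁻ ω, ENNReal.ofReal (quad 1 (ξ k ω - x k ω)) ∂μ
      = ENNReal.ofReal (moment w Φ (vecMulVec (ξ₀ - x₀) (ξ₀ - x₀)) k).trace := fun k => by
    rw [lintegral_quad_eq_trace_moment (θ := fun k ω => (θ₁ k ω, θ₂ k ω))
      (x := fun k ω => ξ k ω - x k ω) (x₀ := ξ₀ - x₀) (Φ := Φ) hw hlaw hθ.measurable hθ.indep
      (fun _ => rfl) (fun k ω => closedLoop_error_step G s₁ s₂ K hs₁ _ _ x₀ ξ₀ k) k PosSemidef.one,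
      Matrix.one_mul]
  -- The transposed steps run backwards in time, so `R` is read at `1 - k` modulo `d₁` to bound the
  -- forward second moments.
  set Q : ℕ → Matrix (Fin n) (Fin n) ℝ := fun k => R ((N - 1) * k + 1) with hQ
  have hQstep : ∀ k v, ∑ s, w s * quad (Q k) ((Φ k s)ᵀ *ᵥ v) ≤ η * quad (Q (k + 1)) v :=
    fun k v => by
    obtain ⟨e1, e2, -⟩ := reversed_certificate_step hd₁ hRper k
    have h1 := hL ((N - 1) * k) v
    rw [e2] at h1
    have h2 := sum_two_mode hw1 (fun s : Fin 2 × Fin 2 => arrival_eq_zero_or_one s.1) hα₁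
      fun t => quad (Q k) (G.Aᵀ *ᵥ v + (pulse d₁ k * t * (L ⬝ᵥ v)) • G.C)
    have h3 : ∀ s : Fin 2 × Fin 2, (Φ k s)ᵀ *ᵥ v
        = G.Aᵀ *ᵥ v + (pulse d₁ k * arrival s.1 * (L ⬝ᵥ v)) • G.C := fun s => by
      rw [hΦ, transpose_add, add_mulVec, transpose_smul, transpose_vecMulVec, smul_mulVec,
        vecMulVec_mulVec, op_smul_eq_smul, smul_smul]
    simp only [h3]
    rw [h2]
    simp only [mul_zero, zero_mul, zero_smul, add_zero, mul_one, hQ]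
    rw [e1]
    exact h1
  obtain ⟨c, hc0, hcq⟩ := exists_quad_le (hR ((N - 1) * 0 + 1)) (vecMulVec (ξ₀ - x₀) (ξ₀ - x₀))
  obtain ⟨E, hE0, hE⟩ : ∃ E : ℝ, 0 < E ∧ ∀ k, (Q k).trace ≤ E :=
    exists_uniform_of_periodic hd₁0 (fun k C C' h h' => h.trans h')
      (fun k C => by
        simp only [hQ]
        rw [(reversed_certificate_step hd₁ hRper k).2.2]) fun k =>
      ⟨max (Q k).trace 1, by positivity, le_max_left _ _⟩
  have hmom : ∀ k, (moment w Φ (vecMulVec (ξ₀ - x₀) (ξ₀ - x₀)) k).trace ≤ c * E * η ^ k :=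
    fun k => by
    have h1 : (moment w Φ (vecMulVec (ξ₀ - x₀) (ξ₀ - x₀)) k).trace ≤ c * η ^ k * (Q k).trace := by
      rw [trace_eq_sum_quad, trace_eq_sum_quad, Finset.mul_sum]
      exact Finset.sum_le_sum fun i _ => quad_moment_le hw hη0.le hc0.le hcq hQstep k _
    have h2 := mul_le_mul_of_nonneg_left (hE k) (mul_nonneg hc0.le (pow_nonneg hη0.le k))
    linarith
  -- the observer state
  obtain ⟨ρ', hρρ', hρ'1⟩ := exists_between hρ1
  have hPperN : ∀ k, P (k + N) = P k := fun k => by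
    obtain ⟨e, he⟩ := hd₂
    have hPp : Function.Periodic P d₂ := hPper
    rw [he, mul_comm d₂ e]
    exact hPp.nat_mul e k
  have hpulseN : ∀ {d : ℕ}, d ∣ N → ∀ k, pulse d (k + N) = pulse d k := fun hd k => by
    simp only [pulse, Nat.dvd_add_left hd]
  obtain ⟨C, hC0, hC⟩ : ∃ C : ℝ, 0 < C ∧ ∀ k, ∀ e y : Fin n → ℝ,
      ∑ s : Fin 2 × Fin 2, w s * quad (P (k + 1))
        (((pulse d₁ k * arrival s.1) • vecMulVec L G.C) *ᵥ e
          + (G.A + (pulse d₂ k * arrival s.2) • vecMulVec G.B F) *ᵥ y)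
        ≤ C * quad 1 e + ρ' * quad (P k) y := by
    refine exists_uniform_of_periodic hN (fun k C C' h hCC' e y => (h e y).trans ?_)
      (fun k C => by
        rw [show k + N + 1 = k + 1 + N by ring, hPperN, hPperN, hpulseN hd₁, hpulseN hd₂])
      fun k => ?_
    · have := mul_le_mul_of_nonneg_right hCC' (quad_nonneg (PosSemidef.one (R := ℝ)) e)
      linarith
    · refine exists_coupled_bound hw PosDef.one (hP k).posSemidef (hP (k + 1)).posSemidef hρ0.le
        hρρ' _ _ fun y => ?_
      have h2 := sum_two_mode hw1 (fun s : Fin 2 × Fin 2 => arrival_eq_zero_or_one s.2) hα₂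
        fun t => quad (P (k + 1)) (G.A *ᵥ y + (pulse d₂ k * t * (F ⬝ᵥ y)) • G.B)
      simp only [add_mulVec, smul_mulVec, vecMulVec_mulVec, op_smul_eq_smul, smul_smul]
      rw [h2]
      simp only [mul_zero, zero_mul, zero_smul, add_zero, mul_one]
      exact hF k y
  have hmx : ∀ k (g : (Fin n → ℝ) × (Fin n → ℝ) → ℝ≥0∞), Measurable fun ω => g (x k ω, ξ k ω) :=
    fun k g => measurable_comp_closedLoop hθ x₀ ξ₀ k g
  have hrec : ∀ k, ∫⁻ ω, ENNReal.ofReal (quad (P (k + 1)) (ξ (k + 1) ω)) ∂μ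
      ≤ ENNReal.ofReal C * ∫⁻ ω, ENNReal.ofReal (quad 1 (ξ k ω - x k ω)) ∂μ
        + ENNReal.ofReal ρ' * ∫⁻ ω, ENNReal.ofReal (quad (P k) (ξ k ω)) ∂μ := fun k => by
    have h1 := lintegral_recursion_succ_ofReal (θ := fun k ω => (θ₁ k ω, θ₂ k ω))
      (z := fun k ω => closedLoop G s₁ s₂ K (θ₁ · ω) (θ₂ · ω) x₀ ξ₀ k) (z₀ := (x₀, ξ₀))
      (f := fun k s p => step G s₁ s₂ K k s.1 s.2 p.1 p.2) hw hlaw hθ.measurable hθ.indep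
      (fun _ => rfl) (fun _ _ => rfl) k (g := fun p => quad (P (k + 1)) p.2)
      fun p => quad_nonneg (hP (k + 1)).posSemidef p.2
    rw [show (∫⁻ ω, ENNReal.ofReal (quad (P (k + 1)) (ξ (k + 1) ω)) ∂μ) = _ from h1,
      ← lintegral_const_mul _ (hmx k fun p => ENNReal.ofReal (quad 1 (p.2 - p.1))),
      ← lintegral_const_mul _ (hmx k fun p => ENNReal.ofReal (quad (P k) p.2)),
      ← lintegral_add_left
        (hmx k fun p => ENNReal.ofReal C * ENNReal.ofReal (quad 1 (p.2 - p.1)))]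
    refine lintegral_mono fun ω => ?_
    rw [← ENNReal.ofReal_mul hC0.le, ← ENNReal.ofReal_mul (hρ0.trans hρρ').le,
      ← ENNReal.ofReal_add (mul_nonneg hC0.le (quad_nonneg PosSemidef.one _))
        (mul_nonneg (hρ0.trans hρρ').le (quad_nonneg (hP k).posSemidef _))]
    refine ENNReal.ofReal_le_ofReal (le_trans (le_of_eq ?_) (hC k _ _))
    refine Finset.sum_congr rfl fun s _ => ?_
    rw [closedLoop_observer_step G s₁ s₂ K hs₁ hs₂]
  obtain ⟨D, r, hD0, hr0, hr1, hDe, hDξ⟩ := exists_geometric_bound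
    (a := fun k => ∫⁻ ω, ENNReal.ofReal (quad 1 (ξ k ω - x k ω)) ∂μ)
    (v := fun k => ∫⁻ ω, ENNReal.ofReal (quad (P k) (ξ k ω)) ∂μ) (v₀ := quad (P 0) ξ₀)
    hC0.le (hρ0.trans hρρ').le hρ'1 hη0.le hη1 (mul_nonneg hc0.le hE0.le)
    (by simp [hξ, closedLoop]) (fun k => by
      rw [herr]
      exact ENNReal.ofReal_le_ofReal (hmom k)) hrec
  -- summation
  obtain ⟨B, hB0, hB⟩ : ∃ B : ℝ, 0 < B ∧ ∀ k, ∀ y, quad 1 y ≤ B * quad (P k) y :=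
    exists_uniform_of_periodic hN (fun k C C' h hCC' y => (h y).trans
      (mul_le_mul_of_nonneg_right hCC' (quad_nonneg (hP k).posSemidef y)))
      (fun k C => by rw [hPperN]) fun k => exists_quad_le (hP k) 1
  -- From `x = ξ - (ξ - x)` one gets `|x|² + |ξ|² ≤ 2 |ξ - x|² + 3 |ξ|²`.
  have hpt : ∀ k ω, quad 1 (x k ω) + quad 1 (ξ k ω)
      ≤ 2 * quad 1 (ξ k ω - x k ω) + 3 * B * quad (P k) (ξ k ω) := fun k ω => by
    have h1 := quad_add_le (PosSemidef.one (n := Fin n) (R := ℝ)) one_pos (ξ k ω)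
      ((-1 : ℝ) • (ξ k ω - x k ω))
    rw [quad_smul_vec, neg_one_smul, ← sub_eq_add_neg, sub_sub_cancel] at h1
    have h2 := hB k (ξ k ω)
    linarith
  have hterm : ∀ k, ∫⁻ ω, ENNReal.ofReal (quad 1 (x k ω) + quad 1 (ξ k ω)) ∂μ
      ≤ ENNReal.ofReal ((2 + 3 * B) * D * r ^ k) := fun k => by
    calc ∫⁻ ω, ENNReal.ofReal (quad 1 (x k ω) + quad 1 (ξ k ω)) ∂μ
        ≤ ∫⁻ ω, (ENNReal.ofReal 2 * ENNReal.ofReal (quad 1 (ξ k ω - x k ω))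
            + ENNReal.ofReal (3 * B) * ENNReal.ofReal (quad (P k) (ξ k ω))) ∂μ := by
          refine lintegral_mono fun ω => ?_
          rw [← ENNReal.ofReal_mul (by norm_num), ← ENNReal.ofReal_mul (by positivity),
            ← ENNReal.ofReal_add (mul_nonneg (by norm_num) (quad_nonneg PosSemidef.one _))
              (mul_nonneg (by positivity) (quad_nonneg (hP k).posSemidef _))]
          exact ENNReal.ofReal_le_ofReal (hpt k ω)
      _ = ENNReal.ofReal 2 * ∫⁻ ω, ENNReal.ofReal (quad 1 (ξ k ω - x k ω)) ∂μ
            + ENNReal.ofReal (3 * B) * ∫⁻ ω, ENNReal.ofReal (quad (P k) (ξ k ω)) ∂μ := by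
          rw [lintegral_add_left
            (hmx k fun p => ENNReal.ofReal 2 * ENNReal.ofReal (quad 1 (p.2 - p.1))),
            lintegral_const_mul _ (hmx k fun p => ENNReal.ofReal (quad 1 (p.2 - p.1))),
            lintegral_const_mul _ (hmx k fun p => ENNReal.ofReal (quad (P k) p.2))]
      _ ≤ ENNReal.ofReal 2 * ENNReal.ofReal (D * r ^ k)
            + ENNReal.ofReal (3 * B) * ENNReal.ofReal (D * r ^ k) := by
          gcongr
          · exact hDe k
          · exact hDξ k
      _ = ENNReal.ofReal ((2 + 3 * B) * D * r ^ k) := by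
          rw [← ENNReal.ofReal_mul (by norm_num), ← ENNReal.ofReal_mul (by positivity),
            ← ENNReal.ofReal_add (by positivity) (by positivity)]
          congr 1
          ring
  simp only [← quad_one]
  rw [lintegral_tsum fun k => (measurable_comp_closedLoop hθ x₀ ξ₀ k fun p =>
    ENNReal.ofReal (quad 1 p.1 + quad 1 p.2)).aemeasurable]
  refine (ENNReal.tsum_le_tsum hterm).trans_lt (Summable.tsum_ofReal_lt_top ?_)
  exact (summable_geometric_of_lt_one hr0 hr1).mul_left _

end Sufficiency

end RemoteControl

/-! ### The theorem. -/

theorem proposition2 {n N : ℕ} [NeZero N] (G : RemoteControl.Plant n)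
    (hcontrollable : G.Controllable) (hobservable : G.Observable)
    (hunstable : RemoteControl.Unstable G.A)
    (s₁ s₂ : Fin N → Fin 2) (N₁ N₂ : ℕ)
    (hs₁ : RemoteControl.IsPeriodicVector s₁) (hN₁ : RemoteControl.numOnes s₁ = N₁)
    (hs₂ : RemoteControl.IsPeriodicVector s₂) (hN₂ : RemoteControl.numOnes s₂ = N₂)
    {Ω : Type*} [MeasurableSpace Ω] (μ : Measure Ω) [IsProbabilityMeasure μ]
    (θ₁ θ₂ : ℕ → Ω → Fin 2) (α₁ α₂ : ℝ)
    (hθ : RemoteControl.IsLossProcess μ θ₁ θ₂ α₁ α₂) :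
    ((∃ K : RemoteControl.Controller n N,
        RemoteControl.StochasticallyStable μ θ₁ θ₂ G s₁ s₂ K) →
      α₁ < 1 / RemoteControl.unstableProd G.A (2 * N / N₁) ∧
      α₂ < 1 / RemoteControl.unstableProd G.A (2 * N / N₂)) ∧
    (RemoteControl.Nonpathological G.A (N / N₁) → RemoteControl.Nonpathological G.A (N / N₂) →
      ((∃ K : RemoteControl.Controller n N,
          RemoteControl.StochasticallyStable μ θ₁ θ₂ G s₁ s₂ K) ↔
        α₁ < 1 / RemoteControl.unstableProd G.A (2 * N / N₁) ∧
        α₂ < 1 / RemoteControl.unstableProd G.A (2 * N / N₂))) := by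
  subst hN₁ hN₂
  -- `2 * N / Nⱼ` means `(2 * N) / Nⱼ`; divisibility turns it into twice the sampling period.
  rw [Nat.mul_div_assoc _ hs₁.2.1, Nat.mul_div_assoc _ hs₂.2.1,
    lt_div_iff₀ (RemoteControl.unstableProd_pos _ _),
    lt_div_iff₀ (RemoteControl.unstableProd_pos _ _)]
  have hnec : (∃ K : RemoteControl.Controller n N,
      RemoteControl.StochasticallyStable μ θ₁ θ₂ G s₁ s₂ K) → _ := fun ⟨K, hK⟩ =>
    hK.loss_bounds hunstable hθ (RemoteControl.div_numOnes_ne_zero hs₁)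
      (RemoteControl.div_numOnes_ne_zero hs₂) (RemoteControl.switch_eq_pulse hs₁)
      (RemoteControl.switch_eq_pulse hs₂)
  exact ⟨hnec, fun hnp₁ hnp₂ => ⟨hnec, fun hb =>
    RemoteControl.exists_stabilizing_controller hcontrollable hobservable hθ
      (Nat.div_dvd_of_dvd hs₁.2.1) (Nat.div_dvd_of_dvd hs₂.2.1)
      (RemoteControl.switch_eq_pulse hs₁) (RemoteControl.switch_eq_pulse hs₂) hnp₁ hnp₂ hb.1
      hb.2⟩⟩
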